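/- **Setting.** Let $N>1$ be an integer and let $\mathcal O=\mathbb Z$, or $\mathcal O=\mathbb Z_p$ if $N=p$ is prime. Put $A_0=\mathcal O/N\mathcal O=\mathbb Z/N\mathbb Z$. Let $\operatorname{ord}_N(a)=k$ if $a\in N^k\mathcal O\setminus N^{k+1}\mathcal O$, $\operatorname{ord}_N(0)=\infty$. For $f=\sum_s a_sx^s\in\mathcal O[x]$ let $v_0(f)=\min_s \operatorname{ord}_N(a_s)$, let $R_0(f)\in A_0[y]$ be the reduction modulo $N$ of $f/N^{v_0(f)}$ (with $x$ replaced by $y$), and $R_0(0)=0$. A nonzero $a\in\mathcal O$ is stable if $\operatorname{ord}_N(ab)=\operatorname{ord}_N(a)+\operatorname{ord}_N(b)$ for all $b\in\mathcal O$. For a function $v:\mathcal O[x]\to\mathbb Z\cup\{\infty\}$ write $a\sim_v b$ if $a=b=0$ or $v(a-b)>v(a)$. A polynomial over a commutative ring $A$ is strongly unitary if all its nonzero coefficients are units; it is squarefree if its leading coefficient is a unit and its reduction modulo every maximal ideal of $A$ is squarefree. For a monic $g\in\mathcal O[x]$ of positive degree, the canonical $g$-expansion of $f$ is $f=\sum_{s\ge0}a_sg^s$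 with $\deg a_s<\deg g$. **SF-types.** SF-types over $(\mathcal O,\operatorname{ord}_N)$, and the objects attached to them, are defined by recursion on the order. *Order zero.* An SF-type of order $0$ is $\mathbf t=(t_0)$ with $t_0\in A_0[y]$ monic, squarefree, strongly unitary, of positive degree. Put $A_1=A_0[y]/(t_0)$ and let $z_0$ be the class of $y$. A nonzero polynomial is $\mathbf t$-robust if all its nonzero coefficients are stable. A representative of $\mathbf t$ is a monic $\mathbf t$-robust $g\in\mathcal O[x]$ with $R_0(g)=t_0$. Put $z_0^{\nu_0(a)}:=1$ for all $a$. *Order $r\ge1$.* An SF-type of order $r$ is $\mathbf t=(t_0;(g_1,\lambda_1,t_1);\dots;(g_r,\lambda_r,t_r))$, where $\mathbf t_{r-1}=(t_0;\dots;(g_{r-1},\lambda_{r-1},t_{r-1}))$ is an SF-type of order $r-1$, $g_r\in\mathcal O[x]$ is a representative of $\mathbf t_{r-1}$, $\lambda_r=h_r/e_r$ is a positive rational number with $h_r,e_r$ positive and coprime, and $t_r\in A_r[y]$ is monic, squarefree, strongly unitary, of positive degree, with $t_r(0)\ne0$. Put $A_{r+1}=A_r[y]/(t_r)$ and let $z_r$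 be the class of $y$, which is a unit. Let $\ell_rh_r+\ell'_re_r=1$ with integers $\ell_r,\ell'_r$ and $0\le\ell_r<e_r$. For $f\in\mathcal O[x]$ with canonical $g_r$-expansion $f=\sum_sa_sg_r^s$ let $u_s=v_{r-1}(a_sg_r^s)$. - The Newton polygon $N_r(f)\subset\mathbb R^2$ is the lower boundary of the convex hull of $\{(s,u_s)\mid a_s\ne0\}$, and $N_r(0)=\emptyset$. Its principal part $N_r^-(f)$ consists of its sides of negative slope, or of its left endpoint if there are none. - $S_r(f)$ is the segment (possibly one point) of all $(x,y)\in N_r(f)$ at which $y+\lambda_rx$ is minimal; for $f\neq 0$, $(s_r(f),u_r(f))$ is its left endpoint, and $\nu_r(f)=\ell'_rs_r(f)-\ell_ru_r(f)\in\mathbb Z$. - $v_r(f)=e_r\min_s\{u_s+s\lambda_r\}$ and $v_r(0)=\infty$. - $R_r(f)=c_{s_0}+c_{s_0+e_r}y+\cdots+c_{s_0+de_r}y^d\in A_r[y]$, where $s_0$ and $s_0+de_r$ are the abscissas of the endpoints of $S_r(f)$, and $c_s=z_{r-1}^{\nu_{r-1}(a_s)}R_{r-1}(a_s)(z_{r-1})$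 if $(s,u_s)\in N_r^-(f)$, $c_s=0$ otherwise; $R_r(0)=0$. - A nonzero $f$ is $\mathbf t$-robust if every nonzero coefficient $a_s$ of its canonical $g_r$-expansion is $\mathbf t_{r-1}$-robust and satisfies $\gcd_{A_{r-1}}(R_{r-1}(a_s),t_{r-1})=1$. Here $\gcd_{A_i}(s,t)=d$ means that Euclid's algorithm in $A_i[y]$, started at $(s,t)$ and replacing $t$ by $t'=\operatorname{lc}(t)^{-1}t$ and then $(s,t)$ by $(t',s\bmod t')$ until $t=0$, terminates with output $d$ without crashing; it crashes as soon as a leading coefficient $c=\operatorname{lc}(t)$ fails the test $\gcd_{A_{i-1}}(\tilde c,t_{i-1})=1$, where $\tilde c\in A_{i-1}[y]$ is the lifting of $c$ of degree less than $\deg t_{i-1}$ if $i>0$ (for $i=0$ the test is that an integer lifting $c$ is coprime to $N$). - A representative of $\mathbf t$ is a monic $\mathbf t$-robust $g\in\mathcal O[x]$ with $\deg g=e_r\deg(t_r)\deg(g_r)$ and $R_r(g)=t_r$. **Theorem.** Let $\mathbf t$ be an SF-type of order $r\ge1$ over $(\mathcal O,\operatorname{ord}_N)$, and let $f,h\in\mathcal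 O[x]$ with $f\ne0$. **(A)** $f\sim_{v_r}h$ if and only if $S_r(f)=S_r(h)$ and $R_r(f)=R_r(h)$. **(B)** Suppose $v_r(f)=v_r(h)$ and let $H=f+h$. Then, in $A_r[y,y^{-1}]$, $$y^{\nu_r(f)}R_r(f)+y^{\nu_r(h)}R_r(h)=\begin{cases}0,&\text{if }v_r(H)>v_r(f),\\ y^{\nu_r(H)}R_r(H),&\text{if }v_r(H)=v_r(f).\end{cases}$$ **(C)** If $f$ is $\mathbf t$-robust, then $v_r(fh)=v_r(f)+v_r(h)$, $S_r(fh)=S_r(f)+S_r(h)$ (vector sum of plane segments, with $S+\emptyset=\emptyset$) and $R_r(fh)=R_r(f)R_r(h)$. **(D)** Let $g$ be a representative of $\mathbf t$, and let $f=\sum_{s\ge0}b_sg^s$ be the canonical $g$-expansion of $f$. Then 1. $f\sim_{v_r}gh\ \Longrightarrow\ R_r(f)\in t_rA_r[y]\ \Longrightarrow\ \deg f\ge\deg g$; 2. $v_r(f)=\min\{v_r(b_sg^s)\mid s\ge0\}$. -/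

import Mathlib

open Polynomial
open scoped Pointwise

universe u

namespace SFOM

noncomputable section

/-- The admissible base rings: either `ℤ` with an arbitrary integer `N > 1`, or the ring of
`p`-adic integers with `N = p` prime. -/
def IsBaseRing (O : Type u) [CommRing O] (N : ℕ) : Prop :=
  (1 < N ∧ Nonempty (O ≃+* ℤ)) ∨ ∃ _ : Fact N.Prime, Nonempty (O ≃+* PadicInt N)

/-- `A₀ = O / N O`, that is, `ℤ / N ℤ`. -/
abbrev BaseAlg (O : Type u) [CommRing O] (N : ℕ) : Type u :=
  O ⧸ Ideal.span {(N : O)}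

/-! ### Polynomials over a commutative ring -/

/-- All nonzero coefficients are units. -/
def StronglyUnitary {A : Type u} [CommRing A] (t : A[X]) : Prop :=
  ∀ n, t.coeff n ≠ 0 → IsUnit (t.coeff n)

/-- Unit leading coefficient, and squarefree modulo every maximal ideal. -/
def SquarefreePoly {A : Type u} [CommRing A] (t : A[X]) : Prop :=
  IsUnit t.leadingCoeff ∧
    ∀ M : Ideal A, M.IsMaximal → Squarefree (t.map (Ideal.Quotient.mk M))

/-- Conditions common to all moduli of a type. -/
def IsModulus {A : Type u} [CommRing A] (t : A[X]) : Prop :=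
  t.Monic ∧ SquarefreePoly t ∧ StronglyUnitary t ∧ 0 < t.natDegree

/-- `EuclidGcd P s t d` : Euclid's algorithm, started at `(s, t)`, terminates without crashing
and outputs `d`. `P a` says that the test on a leading coefficient `a` is passed; the algorithm
crashes on the first failure of this test. Each step replaces `t` by `t' = lc(t)⁻¹ t` and then
`(s, t)` by `(t', s mod t')`, until `t = 0`. -/
inductive EuclidGcd {A : Type u} [CommRing A] (P : A → Prop) : A[X] → A[X] → A[X] → Prop
  | done (s : A[X]) : EuclidGcd P s 0 s
  | step (s t d : A[X]) (ht : t ≠ 0) (hP : P t.leadingCoeff)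
      (hrec : EuclidGcd P (C (Ring.inverse t.leadingCoeff) * t)
        (s %ₘ (C (Ring.inverse t.leadingCoeff) * t)) d) :
      EuclidGcd P s t d

/-- The leading coefficient test in `A[y] / (t)`: identify the element `a` with a polynomial of
degree less than `deg t`, and test whether its gcd with `t` in `A[y]` is computed and equals `1`. -/
def quotTest {A : Type u} [CommRing A] (P : A → Prop) (t : A[X]) (a : AdjoinRoot t) : Prop :=
  ∃ p : A[X], p.degree < t.degree ∧ AdjoinRoot.mk t p = a ∧ EuclidGcd P p t 1

/-- The leading coefficient test in `A₀`: an integer lifting `a` is coprime to `N`. -/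
def baseTest (O : Type u) [CommRing O] (N : ℕ) (a : BaseAlg O N) : Prop :=
  ∃ k : ℤ, (k : BaseAlg O N) = a ∧ Int.gcd k N = 1

/-- Coefficient `a_s` of the canonical `g`-expansion `f = ∑ a_s g ^ s`, `deg a_s < deg g`
(for `g` monic of positive degree). -/
def adicCoeff {O : Type u} [CommRing O] (g : O[X]) : ℕ → O[X] → O[X]
  | 0, f => f %ₘ g
  | s + 1, f => adicCoeff g s (f /ₘ g)

/-- Integer powers of a unit. -/
def unitZPow {A : Type u} [CommRing A] (z : A) (n : ℤ) : A :=
  open Classical in if hz : IsUnit z then ((hz.unit ^ n : Aˣ) : A) else 0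

/-! ### The `N`-adic pseudo-valuation -/

/-- `ord_N(a) = k` if `a ∈ N ^ k O` and `a ∉ N ^ (k + 1) O`; `ord_N(0) = ∞`. -/
def ordN {O : Type u} [CommRing O] (N : ℕ) (a : O) : ℕ∞ :=
  emultiplicity (N : O) a

/-- The extension `v₀` of `ord_N` to polynomials. -/
def val0 {O : Type u} [CommRing O] (N : ℕ) (f : O[X]) : ℕ∞ :=
  ⨅ s : ℕ, ordN N (f.coeff s)

/-- The residual polynomial operator of order zero: reduction modulo `N` of `f / N ^ v₀(f)`. -/
def res0 {O : Type u} [CommRing O] (N : ℕ) (f : O[X]) : (BaseAlg O N)[X] :=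
  open Classical in
  if hf : f ≠ 0 ∧ ∃ q : O[X], f = C ((N : O) ^ (val0 N f).toNat) * q then
    hf.2.choose.map (Ideal.Quotient.mk (Ideal.span {(N : O)}))
  else 0

/-- Nonzero stable elements of `O`. -/
def Stable {O : Type u} [CommRing O] (N : ℕ) (a : O) : Prop :=
  a ≠ 0 ∧ ∀ b : O, ordN N (a * b) = ordN N a + ordN N b

/-- `N`-robust polynomials. -/
def Robust0 {O : Type u} [CommRing O] (N : ℕ) (f : O[X]) : Prop :=
  f ≠ 0 ∧ ∀ s, f.coeff s ≠ 0 → Stable N (f.coeff s)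

/-- `v`-equivalence. -/
def VEquiv {O : Type u} [CommRing O] (v : O[X] → ℕ∞) (a b : O[X]) : Prop :=
  (a = 0 ∧ b = 0) ∨ v a < v (a - b)

/-! ### Newton polygons -/

/-- The points `(s, u_s)`, where `u_s = v(a_s g ^ s)` and `a_s ≠ 0`. -/
def cloud {O : Type u} [CommRing O] (v : O[X] → ℕ∞) (g f : O[X]) : Set (ℝ × ℝ) :=
  {P | ∃ s n : ℕ, adicCoeff g s f ≠ 0 ∧ v (adicCoeff g s f * g ^ s) = n ∧ P = ((s : ℝ), (n : ℝ))}

/-- Lower boundary of the convex hull. -/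
def lowerHull (P : Set (ℝ × ℝ)) : Set (ℝ × ℝ) :=
  {p | p ∈ convexHull ℝ P ∧ ∀ q ∈ convexHull ℝ P, q.1 = p.1 → p.2 ≤ q.2}

/-- The Newton polygon of `f` with respect to `v` and `g`. -/
def newtonPolygon {O : Type u} [CommRing O] (v : O[X] → ℕ∞) (g f : O[X]) : Set (ℝ × ℝ) :=
  lowerHull (cloud v g f)

/-- The principal part of a polygon: the union of its sides of negative slope, or its left
endpoint if there are none. Equivalently, the points up to which the polygon strictly
decreases. -/
def principalPart (Q : Set (ℝ × ℝ)) : Set (ℝ × ℝ) :=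
  {p | p ∈ Q ∧ ∀ q ∈ Q, q.1 < p.1 → p.2 < q.2}

/-- The `lam`-component: the points where `y + lam * x` is minimal. -/
def component (lam : ℚ) (Q : Set (ℝ × ℝ)) : Set (ℝ × ℝ) :=
  {p | p ∈ Q ∧ ∀ q ∈ Q, p.2 + (lam : ℝ) * p.1 ≤ q.2 + (lam : ℝ) * q.1}

/-- The segment attached to `v`, `g` and the slope `-lam`. -/
def segmentOf {O : Type u} [CommRing O] (v : O[X] → ℕ∞) (g : O[X]) (lam : ℚ) (f : O[X]) :
    Set (ℝ × ℝ) :=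
  component lam (newtonPolygon v g f)

/-- Abscissa of the left endpoint of a segment whose endpoints have coordinates in `ℕ`. -/
def leftAbscissa (S : Set (ℝ × ℝ)) : ℕ :=
  sInf {s : ℕ | ∃ n : ℕ, ((s : ℝ), (n : ℝ)) ∈ S}

/-- Abscissa of the right endpoint of a segment whose endpoints have coordinates in `ℕ`. -/
def rightAbscissa (S : Set (ℝ × ℝ)) : ℕ :=
  sSup {s : ℕ | ∃ n : ℕ, ((s : ℝ), (n : ℝ)) ∈ S}

/-- Ordinate of the left endpoint of a segment whose endpoints have coordinates in `ℕ`. -/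
def leftOrdinate (S : Set (ℝ × ℝ)) : ℕ :=
  sInf {n : ℕ | ((leftAbscissa S : ℝ), (n : ℝ)) ∈ S}

/-- `h`, where `lam = h / e` in lowest terms, `lam > 0`. -/
def slopeNum (lam : ℚ) : ℕ := lam.num.toNat

/-- `e`, where `lam = h / e` in lowest terms. -/
def slopeDen (lam : ℚ) : ℕ := lam.den

/-- `ℓ`, determined by `ℓ h + ℓ' e = 1` and `0 ≤ ℓ < e`. -/
def bezL (lam : ℚ) : ℤ := Nat.gcdA (slopeNum lam) (slopeDen lam) % (slopeDen lam : ℤ)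

/-- `ℓ'`, determined by `ℓ h + ℓ' e = 1`. -/
def bezL' (lam : ℚ) : ℤ := (1 - bezL lam * (slopeNum lam : ℤ)) / (slopeDen lam : ℤ)

theorem bezout_spec (lam : ℚ) (hlam : 0 < lam) :
    bezL lam * (slopeNum lam : ℤ) + bezL' lam * (slopeDen lam : ℤ) = 1 ∧
      0 ≤ bezL lam ∧ bezL lam < (slopeDen lam : ℤ) := by
  have he : (0 : ℤ) < (slopeDen lam : ℤ) := by
    unfold slopeDen; exact_mod_cast lam.den_pos
  have hn : 0 < lam.num := Rat.num_pos.mpr hlam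
  have hco : Nat.gcd (slopeNum lam) (slopeDen lam) = 1 := by
    have hr := lam.reduced
    unfold slopeNum slopeDen
    rwa [show lam.num.toNat = lam.num.natAbs by omega]
  have hb := Nat.gcd_eq_gcd_ab (slopeNum lam) (slopeDen lam)
  rw [hco] at hb
  have hd : (slopeDen lam : ℤ) ∣ 1 - bezL lam * (slopeNum lam : ℤ) := by
    refine ⟨Nat.gcdB (slopeNum lam) (slopeDen lam) +
      (slopeNum lam : ℤ) * (Nat.gcdA (slopeNum lam) (slopeDen lam) / (slopeDen lam : ℤ)), ?_⟩
    have hm := Int.emod_add_mul_ediv (Nat.gcdA (slopeNum lam) (slopeDen lam)) (slopeDen lam : ℤ)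
    unfold bezL
    push_cast at hb
    linear_combination hb - (slopeNum lam : ℤ) * hm
  refine ⟨?_, Int.emod_nonneg _ he.ne', Int.emod_lt_of_pos _ he⟩
  have := Int.ediv_mul_cancel hd
  unfold bezL'
  linarith

/-- `ν(f) = ℓ' s(f) - ℓ u(f)`, where `(s(f), u(f))` is the left endpoint of the segment of `f`. -/
def nuOf {O : Type u} [CommRing O] (v : O[X] → ℕ∞) (g : O[X]) (lam : ℚ) (f : O[X]) : ℤ :=
  bezL' lam * (leftAbscissa (segmentOf v g lam f) : ℤ) -
    bezL lam * (leftOrdinate (segmentOf v g lam f) : ℤ)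

/-- The pseudo-valuation attached to `v`, `g` and `lam = h / e`:
`e * min (u_s + s * lam) = min (e * u_s + s * h)`. -/
def valOf {O : Type u} [CommRing O] (v : O[X] → ℕ∞) (g : O[X]) (lam : ℚ) (f : O[X]) : ℕ∞ :=
  ⨅ s : ℕ, ((slopeDen lam : ℕ∞) * v (adicCoeff g s f * g ^ s) + (s : ℕ∞) * (slopeNum lam : ℕ∞))

/-- The residual coefficient `c_s` of `f`: it is `c(a_s)` if the point `(s, u_s)` lies on the
principal Newton polygon of `f`, and zero otherwise. -/
def resCoeff {O : Type u} [CommRing O] {A : Type u} [CommRing A] (v : O[X] → ℕ∞) (c : O[X] → A)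
    (g f : O[X]) (s : ℕ) : A :=
  open Classical in
  if ∃ n : ℕ, v (adicCoeff g s f * g ^ s) = n ∧
      ((s : ℝ), (n : ℝ)) ∈ principalPart (newtonPolygon v g f) then
    c (adicCoeff g s f)
  else 0

/-- The residual polynomial `c_{s₀} + c_{s₀+e} y + ⋯ + c_{s₀+de} y ^ d`, where `s₀` and `s₀ + d e`
are the abscissas of the endpoints of the segment of `f`. For `f = 0` the polygon is empty and
this polynomial is zero. -/
def resPolyOf {O : Type u} [CommRing O] {A : Type u} [CommRing A] (v : O[X] → ℕ∞) (c : O[X] → A)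
    (g : O[X]) (lam : ℚ) (f : O[X]) : A[X] :=
  ∑ j ∈ Finset.range
      ((rightAbscissa (segmentOf v g lam f) - leftAbscissa (segmentOf v g lam f)) / slopeDen lam + 1),
    C (resCoeff v c g f (leftAbscissa (segmentOf v g lam f) + j * slopeDen lam)) * X ^ j

/-! ### Types -/

/-- Raw data `(t₀; (g₁, λ₁, t₁); …; (g_r, λ_r, t_r))` of order `r`. The index `A` is the algebra
`A_{r+1} = A_r[y] / (t_r)` attached to the data, where `A₀ = O / N O`. -/
inductive TypeData (O : Type u) [CommRing O] (N : ℕ) :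
    ℕ → (A : Type u) → CommRing A → Type (u + 1)
  | base (t : (BaseAlg O N)[X]) : TypeData O N 0 (AdjoinRoot t) inferInstance
  | extend {r : ℕ} {A : Type u} {inst : CommRing A} (T : TypeData O N r A inst)
      (g : O[X]) (lam : ℚ) (t : A[X]) : TypeData O N (r + 1) (AdjoinRoot t) inferInstance

namespace TypeData

/-- The pseudo-valuation `v_r`. -/
def val {O : Type u} [CommRing O] {N : ℕ} : {r : ℕ} → {A : Type u} → {inst : CommRing A} →
    TypeData O N r A inst → O[X] → ℕ∞
  | _, _, _, base _ => val0 N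
  | _, _, _, extend T g lam _ => valOf T.val g lam

/-- `z_r ^ ν_r(a) * R_r(a)(z_r)` in `A_{r+1}`, where `z_r` is the class of `y`; for `r = 0` the
first factor is omitted. -/
def resValue {O : Type u} [CommRing O] {N : ℕ} : {r : ℕ} → {A : Type u} → {inst : CommRing A} →
    TypeData O N r A inst → O[X] → A
  | _, _, _, base t => fun a => AdjoinRoot.mk t (res0 N a)
  | _, _, _, extend T g lam t => fun a =>
      unitZPow (AdjoinRoot.root t) (nuOf T.val g lam a) *
        AdjoinRoot.mk t (resPolyOf T.val T.resValue g lam a)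

/-- The test, in `A_{r+1}`, that the gcd routine over `A_r` applied to `(a, t_r)` outputs `1`. -/
def unitTest {O : Type u} [CommRing O] {N : ℕ} : {r : ℕ} → {A : Type u} → {inst : CommRing A} →
    TypeData O N r A inst → A → Prop
  | _, _, _, base t => quotTest (baseTest O N) t
  | _, _, _, extend T _ _ t => quotTest T.unitTest t

/-- `gcd(R_r(a), t_r) = 1` in `A_r[y]`, in the sense of the gcd routine. -/
def GcdOne {O : Type u} [CommRing O] {N : ℕ} : {r : ℕ} → {A : Type u} → {inst : CommRing A} →
    TypeData O N r A inst → O[X] → Prop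
  | _, _, _, base t => fun a => EuclidGcd (baseTest O N) (res0 N a) t 1
  | _, _, _, extend T g lam t => fun a =>
      EuclidGcd T.unitTest (resPolyOf T.val T.resValue g lam a) t 1

/-- Robust polynomials with respect to a type. -/
def Robust {O : Type u} [CommRing O] {N : ℕ} : {r : ℕ} → {A : Type u} → {inst : CommRing A} →
    TypeData O N r A inst → O[X] → Prop
  | _, _, _, base _ => Robust0 N
  | _, _, _, extend T g _ _ => fun f =>
      f ≠ 0 ∧ ∀ s, adicCoeff g s f ≠ 0 → T.Robust (adicCoeff g s f) ∧ T.GcdOne (adicCoeff g s f)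

/-- Representatives of a type. -/
def IsRepresentative {O : Type u} [CommRing O] {N : ℕ} : {r : ℕ} → {A : Type u} →
    {inst : CommRing A} → TypeData O N r A inst → O[X] → Prop
  | _, _, _, base t => fun G => G.Monic ∧ (base (O := O) (N := N) t).Robust G ∧ res0 N G = t
  | _, _, _, extend T g lam t => fun G =>
      G.Monic ∧ (extend T g lam t).Robust G ∧
        G.natDegree = slopeDen lam * t.natDegree * g.natDegree ∧
        resPolyOf T.val T.resValue g lam G = t

/-- The data form an SF-type over `(O, ord_N)`. -/
def IsSFType {O : Type u} [CommRing O] {N : ℕ} : {r : ℕ} → {A : Type u} → {inst : CommRing A} →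
    TypeData O N r A inst → Prop
  | _, _, _, base t => IsModulus t
  | _, _, _, extend T g lam t =>
      T.IsSFType ∧ T.IsRepresentative g ∧ 0 < lam ∧ IsModulus t ∧ t.eval 0 ≠ 0

/-- The segment `S_{r+1}(f)` of the type `(T; (g, lam, t))` extending `T` of order `r`. -/
def segment {O : Type u} [CommRing O] {N : ℕ} {r : ℕ} {A : Type u} {inst : CommRing A}
    (T : TypeData O N r A inst) (g : O[X]) (lam : ℚ) : O[X] → Set (ℝ × ℝ) :=
  segmentOf T.val g lam

/-- `ν_{r+1}(f)` for the type `(T; (g, lam, t))` extending `T` of order `r`. -/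
def nu {O : Type u} [CommRing O] {N : ℕ} {r : ℕ} {A : Type u} {inst : CommRing A}
    (T : TypeData O N r A inst) (g : O[X]) (lam : ℚ) : O[X] → ℤ :=
  nuOf T.val g lam

/-- `R_{r+1}(f)` for the type `(T; (g, lam, t))` extending `T` of order `r`. -/
def resPoly {O : Type u} [CommRing O] {N : ℕ} {r : ℕ} {A : Type u} {inst : CommRing A}
    (T : TypeData O N r A inst) (g : O[X]) (lam : ℚ) : O[X] → A[X] :=
  resPolyOf T.val T.resValue g lam

end TypeData

end

end SFOM

/-! Each pseudo-valuation `v` of a type comes with a residue map `c`, sending `f` to `z^ν R(f)(z)`.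
One invariant is carried through the orders. First, `c` taken degree by degree is additive and
multiplicative on the graded algebra of `v` (`IsResidual`). Second, a representative `g` is a key
polynomial (`IsKey`): multiplication by `g` shifts values by exactly `v g`, `c g = 0`, and `c` kills
no nonzero polynomial of degree below `deg g`. Hence no cancellation occurs in a canonical
`g`-expansion, and `v f` is the minimum over its terms (`IsKey.isLeast_val`).

For the next order, the residues of the coefficients lying on the line `e y + h x = β` are collected
in a Laurent polynomial, `lineForm`. When two monomials are multiplied, the remainder modulo `g`
stays at the expected abscissa, while the quotient moves one step right and, the slope being
negative, lies strictly above the line. This makes `lineForm` multiplicative (`lineForm_mul`). For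
`β = v_r(f)` it equals `y^ν R_r(f)` (`exists_isEdge`), which is nonzero. So `lineForm` vanishes only
on polynomials of value above `β`, and `y^ν R_r(f)` determines the graded class of `f`.

(A) and (B) are this injectivity and the additivity of `lineForm`. For (C), the gcd conditions turn
the end coefficients of `R_r(f)` into units, so nothing is lost in the product of residual
polynomials. Evaluating `lineForm` at `z` restores the invariant one order higher
(`gradedPart_extResidue`, `isKey_extend`), where `IsKey.isLeast_val` is (D2). (D1) follows from (A),
(C) and a degree bound read off the right endpoint of the segment. -/

namespace SFOM

/-! ### Canonical expansions with respect to a monic polynomial. -/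

section Adic

variable {O : Type u} [CommRing O] {g : O[X]}

theorem adicCoeff_zero (g f : O[X]) : adicCoeff g 0 f = f %ₘ g := rfl

theorem adicCoeff_succ (g f : O[X]) (s : ℕ) :
    adicCoeff g (s + 1) f = adicCoeff g s (f /ₘ g) := rfl

theorem adicCoeff_zero_add_mul (hg : g.Monic) {a q : O[X]} (ha : a.degree < g.degree) :
    adicCoeff g 0 (a + g * q) = a :=
  (div_modByMonic_unique q a hg ⟨rfl, ha⟩).2

theorem adicCoeff_succ_add_mul (hg : g.Monic) {a q : O[X]} (ha : a.degree < g.degree) (s : ℕ) :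
    adicCoeff g (s + 1) (a + g * q) = adicCoeff g s q := by
  rw [adicCoeff_succ, (div_modByMonic_unique q a hg ⟨rfl, ha⟩).1]

theorem adicCoeff_add (hg : g.Monic) (s : ℕ) (f f' : O[X]) :
    adicCoeff g s (f + f') = adicCoeff g s f + adicCoeff g s f' := by
  induction s generalizing f f' with
  | zero => exact add_modByMonic f f'
  | succ s ih =>
    rw [adicCoeff_succ, adicCoeff_succ, adicCoeff_succ, ← ih]
    congr 1
    nontriviality O
    refine (div_modByMonic_unique (f /ₘ g + f' /ₘ g) (f %ₘ g + f' %ₘ g) hg ⟨?_, ?_⟩).1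
    · conv_rhs => rw [← modByMonic_add_div f g, ← modByMonic_add_div f' g]
      ring
    · exact (degree_add_le _ _).trans_lt
        (max_lt (degree_modByMonic_lt _ hg) (degree_modByMonic_lt _ hg))

theorem adicCoeff_of_zero (hg : g.Monic) (s : ℕ) : adicCoeff g s (0 : O[X]) = 0 := by
  have := adicCoeff_add hg s 0 0
  simpa using this

theorem degree_adicCoeff_lt [Nontrivial O] (hg : g.Monic) (s : ℕ) (f : O[X]) :
    (adicCoeff g s f).degree < g.degree := by
  induction s generalizing f with
  | zero => exact degree_modByMonic_lt _ hg
  | succ s ih => exact ih _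

theorem adicCoeff_mul_pow [Nontrivial O] (hg : g.Monic) {a : O[X]} (ha : a.degree < g.degree)
    (s t : ℕ) : adicCoeff g t (a * g ^ s) = if t = s then a else 0 := by
  have h0 : (0 : O[X]).degree < g.degree := by
    rw [degree_zero, bot_lt_iff_ne_bot]; exact degree_ne_bot.mpr hg.ne_zero
  induction s generalizing t with
  | zero =>
    have : a * g ^ 0 = a + g * 0 := by simp
    rw [this]
    cases t with
    | zero => rw [adicCoeff_zero_add_mul hg ha, if_pos rfl]
    | succ t =>
      rw [adicCoeff_succ_add_mul hg ha, adicCoeff_of_zero hg, if_neg (Nat.succ_ne_zero t)]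
  | succ s ih =>
    have : a * g ^ (s + 1) = 0 + g * (a * g ^ s) := by ring
    rw [this]
    cases t with
    | zero => rw [adicCoeff_zero_add_mul hg h0, if_neg (Nat.succ_ne_zero s).symm]
    | succ t => simp only [adicCoeff_succ_add_mul hg h0, ih, Nat.add_right_cancel_iff]

theorem divByMonic_eq_zero_of_natDegree_lt (hg : g.Monic) {f : O[X]}
    (h : f.natDegree < g.natDegree) : f /ₘ g = 0 := by
  nontriviality O
  exact (divByMonic_eq_zero_iff hg).2 (degree_lt_degree h)

theorem mul_natDegree_le_of_adicCoeff_ne_zero (hg : g.Monic) {s : ℕ} {f : O[X]}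
    (h : adicCoeff g s f ≠ 0) : s * g.natDegree ≤ f.natDegree := by
  induction s generalizing f with
  | zero => simp
  | succ s ih =>
    have h1 := ih h
    rw [natDegree_divByMonic f hg] at h1
    by_cases hlt : f.natDegree < g.natDegree
    · have : f /ₘ g = 0 := divByMonic_eq_zero_of_natDegree_lt hg hlt
      rw [adicCoeff_succ, this, adicCoeff_of_zero hg] at h
      exact absurd rfl h
    · rw [add_mul, one_mul]; omega

theorem adicCoeff_eq_zero (hg : g.Monic) (hpos : 0 < g.natDegree) {s : ℕ} {f : O[X]}
    (h : f.natDegree < s) : adicCoeff g s f = 0 := by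
  by_contra hne
  have := mul_natDegree_le_of_adicCoeff_ne_zero hg hne
  have := Nat.le_mul_of_pos_right s hpos
  omega

/-- The bound on `n` is crude but sufficient: each division by `g` lowers a positive degree by at
least one. -/
theorem sum_adicCoeff_mul_pow (hg : g.Monic) (hpos : 0 < g.natDegree) {n : ℕ} {f : O[X]}
    (h : f.natDegree < n) : ∑ s ∈ Finset.range n, adicCoeff g s f * g ^ s = f := by
  induction n generalizing f with
  | zero => omega
  | succ n ih =>
    rw [Finset.sum_range_succ']
    have key : ∑ k ∈ Finset.range n, adicCoeff g (k + 1) f * g ^ (k + 1) = g * (f /ₘ g) := by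
      have : ∑ k ∈ Finset.range n, adicCoeff g k (f /ₘ g) * g ^ k = f /ₘ g := by
        cases n with
        | zero =>
          have : f /ₘ g = 0 := divByMonic_eq_zero_of_natDegree_lt hg (by omega)
          simp [this]
        | succ n =>
          apply ih
          rw [natDegree_divByMonic f hg]
          omega
      conv_rhs => rw [← this, Finset.mul_sum]
      refine Finset.sum_congr rfl fun k _ => ?_
      rw [adicCoeff_succ]; ring
    rw [key, adicCoeff_zero, pow_zero, mul_one, add_comm]
    exact modByMonic_add_div f g

theorem exists_adicCoeff_ne_zero (hg : g.Monic) (hpos : 0 < g.natDegree) {f : O[X]} (hf : f ≠ 0) :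
    ∃ s, adicCoeff g s f ≠ 0 := by
  by_contra! h
  apply hf
  rw [← sum_adicCoeff_mul_pow hg hpos (Nat.lt_succ_self f.natDegree)]
  simp [h]

end Adic

/-! ### Supporting lines of plane point sets and their lower hulls. -/

section Geometry

/-- The points of the line `y + lam * x = m` with abscissa between `a` and `b`. -/
def lineSegment (lam m a b : ℝ) : Set (ℝ × ℝ) :=
  {p | p.2 + lam * p.1 = m ∧ a ≤ p.1 ∧ p.1 ≤ b}

theorem lineSegment_add (lam m m' : ℝ) {a b a' b' : ℝ} (hab : a ≤ b) (hab' : a' ≤ b') :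
    lineSegment lam m a b + lineSegment lam m' a' b' =
      lineSegment lam (m + m') (a + a') (b + b') := by
  ext ⟨x, y⟩
  simp only [Set.mem_add, lineSegment, Set.mem_ofPred_eq, Prod.exists, Prod.mk_add_mk, Prod.mk.injEq]
  constructor
  · rintro ⟨x1, y1, ⟨h1, h2, h3⟩, x2, y2, ⟨h4, h5, h6⟩, rfl, rfl⟩
    refine ⟨by linarith, by linarith, by linarith⟩
  · rintro ⟨h1, h2, h3⟩
    rcases le_total (x - a') b with h | h
    · exact ⟨x - a', m - lam * (x - a'), ⟨by ring, by linarith, h⟩, a', m' - lam * a',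
        ⟨by ring, le_rfl, hab'⟩, by ring, by linarith⟩
    · exact ⟨b, m - lam * b, ⟨by ring, hab, le_rfl⟩, x - b, m' - lam * (x - b),
        ⟨by ring, by linarith, by linarith⟩, by ring, by linarith⟩

variable {lam m : ℝ} {P : Set (ℝ × ℝ)} {a b : ℝ × ℝ}

theorem lineSegment_subset_convexHull (ha : a ∈ P) (hb : b ∈ P) (ham : a.2 + lam * a.1 = m)
    (hbm : b.2 + lam * b.1 = m) : lineSegment lam m a.1 b.1 ⊆ convexHull ℝ P := by
  rintro ⟨x, y⟩ ⟨h1, h2, h3⟩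
  simp only at h1 h2 h3
  rcases (h2.trans h3).eq_or_lt with h | h
  · have : (x, y) = a := by
      have hx : x = a.1 := by linarith
      refine Prod.ext hx ?_
      simp only
      subst hx; linarith
    rw [this]; exact subset_convexHull ℝ P ha
  · refine (convex_convexHull ℝ P).segment_subset (subset_convexHull ℝ P ha)
      (subset_convexHull ℝ P hb) ?_
    have hd : 0 < b.1 - a.1 := by linarith
    refine ⟨(b.1 - x) / (b.1 - a.1), (x - a.1) / (b.1 - a.1), div_nonneg (by linarith) hd.le,
      div_nonneg (by linarith) hd.le, by field_simp; ring, ?_⟩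
    have hx : (b.1 - x) / (b.1 - a.1) * a.1 + (x - a.1) / (b.1 - a.1) * b.1 = x := by
      field_simp; ring
    have h1' : (b.1 - x) / (b.1 - a.1) + (x - a.1) / (b.1 - a.1) = 1 := by
      field_simp; ring
    refine Prod.ext (by simpa using hx) ?_
    have e1 : a.2 = m - lam * a.1 := by linarith
    have e2 : b.2 = m - lam * b.1 := by linarith
    simp only [Prod.snd_add, Prod.smul_snd, smul_eq_mul, e1, e2]
    linear_combination m * h1' - lam * hx - h1

/-- The right-hand side is convex: a proper convex combination involving a point strictly above the
line stays strictly above it. So the hull meets a supporting line only between the extreme points of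
`P` on it. -/
theorem convexHull_subset_of_lineSegment (hm : ∀ p ∈ P, m ≤ p.2 + lam * p.1)
    (hab : ∀ p ∈ P, p.2 + lam * p.1 = m → a.1 ≤ p.1 ∧ p.1 ≤ b.1) :
    convexHull ℝ P ⊆ {p | m < p.2 + lam * p.1} ∪ lineSegment lam m a.1 b.1 := by
  refine convexHull_min (fun p hp => ?_) ?_
  · rcases (hm p hp).eq_or_lt with h | h
    · exact Or.inr ⟨h.symm, hab p hp h.symm⟩
    · exact Or.inl h
  · have gen : ∀ p ∈ {p : ℝ × ℝ | m < p.2 + lam * p.1} ∪ lineSegment lam m a.1 b.1,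
        m ≤ p.2 + lam * p.1 := by
      rintro p (hp | hp)
      · exact le_of_lt hp
      · exact hp.1.ge
    intro p hp q hq α β hα hβ hαβ
    have hsum : (α • p + β • q).2 + lam * (α • p + β • q).1 =
        α * (p.2 + lam * p.1) + β * (q.2 + lam * q.1) := by
      simp only [Prod.snd_add, Prod.fst_add, Prod.smul_snd, Prod.smul_fst, smul_eq_mul]; ring
    rcases hα.eq_or_lt with rfl | hα'
    · obtain rfl : β = 1 := by linarith
      simpa using hq
    rcases hβ.eq_or_lt with rfl | hβ'
    · obtain rfl : α = 1 := by linarith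
      simpa using hp
    have hp' := gen p hp
    have hq' := gen q hq
    have hmm : m = α * m + β * m := by rw [← add_mul, hαβ, one_mul]
    rcases hp with hp | hp
    · left
      show m < _
      rw [hsum]
      have := mul_lt_mul_of_pos_left (show m < _ from hp) hα'
      have := mul_le_mul_of_nonneg_left hq' hβ
      linarith
    rcases hq with hq | hq
    · left
      show m < _
      rw [hsum]
      have := mul_lt_mul_of_pos_left (show m < _ from hq) hβ'
      have := mul_le_mul_of_nonneg_left hp' hα
      linarith
    · right
      refine ⟨?_, ?_, ?_⟩
      · rw [hsum, hp.1, hq.1, ← hmm]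
      · simp only [Prod.fst_add, Prod.smul_fst, smul_eq_mul]
        have := mul_le_mul_of_nonneg_left hp.2.1 hα
        have := mul_le_mul_of_nonneg_left hq.2.1 hβ
        have : a.1 = α * a.1 + β * a.1 := by rw [← add_mul, hαβ, one_mul]
        linarith
      · simp only [Prod.fst_add, Prod.smul_fst, smul_eq_mul]
        have := mul_le_mul_of_nonneg_left hp.2.2 hα
        have := mul_le_mul_of_nonneg_left hq.2.2 hβ
        have : b.1 = α * b.1 + β * b.1 := by rw [← add_mul, hαβ, one_mul]
        linarith

theorem lineSegment_subset_lowerHull (ha : a ∈ P) (hb : b ∈ P) (ham : a.2 + lam * a.1 = m)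
    (hbm : b.2 + lam * b.1 = m) (hm : ∀ p ∈ convexHull ℝ P, m ≤ p.2 + lam * p.1) :
    lineSegment lam m a.1 b.1 ⊆ lowerHull P := by
  intro p hp
  refine ⟨lineSegment_subset_convexHull ha hb ham hbm hp, fun q hq hqp => ?_⟩
  have := hm q hq
  rw [hqp] at this
  linarith [hp.1]

theorem le_of_mem_convexHull (hm : ∀ p ∈ P, m ≤ p.2 + lam * p.1) :
    ∀ p ∈ convexHull ℝ P, m ≤ p.2 + lam * p.1 := by
  have hconv : Convex ℝ {p : ℝ × ℝ | m ≤ p.2 + lam * p.1} := by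
    intro p hp q hq α β hα hβ hαβ
    simp only [Set.mem_ofPred_eq, Prod.snd_add, Prod.fst_add, Prod.smul_snd, Prod.smul_fst,
      smul_eq_mul] at *
    have := mul_le_mul_of_nonneg_left hp hα
    have := mul_le_mul_of_nonneg_left hq hβ
    have : m = α * m + β * m := by rw [← add_mul, hαβ, one_mul]
    linarith
  exact fun p hp => convexHull_min hm hconv hp

theorem component_lowerHull {lam : ℚ} (ha : a ∈ P) (hb : b ∈ P)
    (ham : a.2 + (lam : ℝ) * a.1 = m) (hbm : b.2 + (lam : ℝ) * b.1 = m)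
    (hm : ∀ p ∈ P, m ≤ p.2 + (lam : ℝ) * p.1)
    (hab : ∀ p ∈ P, p.2 + (lam : ℝ) * p.1 = m → a.1 ≤ p.1 ∧ p.1 ≤ b.1) :
    component lam (lowerHull P) = lineSegment lam m a.1 b.1 := by
  have hm' := le_of_mem_convexHull hm
  have hsub := lineSegment_subset_lowerHull ha hb ham hbm hm'
  have haL : a ∈ lowerHull P := hsub ⟨ham, le_rfl, (hab a ha ham).2⟩
  ext p
  constructor
  · rintro ⟨hp, hpmin⟩
    rcases convexHull_subset_of_lineSegment hm hab hp.1 with h | h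
    · have h1 := hpmin a haL
      have h2 : m < p.2 + (lam : ℝ) * p.1 := h
      linarith
    · exact h
  · intro hp
    refine ⟨hsub hp, fun q hq => ?_⟩
    rw [hp.1]
    exact hm' q hq.1

/-- Between `a` and `b` the hull contains the point of the line below `p`, so `p` can lie on the
lower hull only if it lies on the line. Conversely, a positive `lam` makes anything further left
strictly higher. -/
theorem mem_principalPart_iff (hlam : 0 < lam) (ha : a ∈ P) (hb : b ∈ P)
    (ham : a.2 + lam * a.1 = m) (hbm : b.2 + lam * b.1 = m)
    (hm : ∀ p ∈ P, m ≤ p.2 + lam * p.1) {p : ℝ × ℝ} (hp : p ∈ P)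
    (hap : a.1 ≤ p.1) (hpb : p.1 ≤ b.1) :
    p ∈ principalPart (lowerHull P) ↔ p.2 + lam * p.1 = m := by
  have hm' := le_of_mem_convexHull hm
  constructor
  · rintro ⟨⟨h1, h2⟩, -⟩
    have h3 := h2 (p.1, m - lam * p.1)
      (lineSegment_subset_convexHull ha hb ham hbm ⟨by simp, hap, hpb⟩) rfl
    simp only at h3
    linarith [hm p hp]
  · intro h
    refine ⟨lineSegment_subset_lowerHull ha hb ham hbm hm' ⟨h, hap, hpb⟩, fun q hq hqp => ?_⟩
    have := hm' q hq.1
    have := mul_lt_mul_of_pos_left hqp hlam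
    linarith

variable {s₀ s₁ u₀ u₁ : ℕ}

theorem leftAbscissa_lineSegment (h : (s₀ : ℝ) ≤ s₁) (h0 : (u₀ : ℝ) + lam * s₀ = m) :
    leftAbscissa (lineSegment lam m s₀ s₁) = s₀ := by
  refine IsLeast.csInf_eq ⟨⟨u₀, h0, le_rfl, h⟩, ?_⟩
  rintro s ⟨n, hn⟩
  exact Nat.cast_le.mp hn.2.1

theorem rightAbscissa_lineSegment (h : (s₀ : ℝ) ≤ s₁) (h1 : (u₁ : ℝ) + lam * s₁ = m) :
    rightAbscissa (lineSegment lam m s₀ s₁) = s₁ := by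
  refine IsGreatest.csSup_eq ⟨⟨u₁, h1, h, le_rfl⟩, ?_⟩
  rintro s ⟨n, hn⟩
  exact Nat.cast_le.mp hn.2.2

theorem leftOrdinate_lineSegment (h : (s₀ : ℝ) ≤ s₁) (h0 : (u₀ : ℝ) + lam * s₀ = m) :
    leftOrdinate (lineSegment lam m s₀ s₁) = u₀ := by
  unfold leftOrdinate
  rw [leftAbscissa_lineSegment h h0]
  have : {n : ℕ | ((s₀ : ℝ), (n : ℝ)) ∈ lineSegment lam m s₀ s₁} = {u₀} := by
    ext n
    constructor
    · intro hn
      have h1 : (n : ℝ) + lam * s₀ = m := hn.1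
      have : (n : ℝ) = u₀ := by linarith
      exact_mod_cast this
    · rintro rfl
      exact ⟨h0, le_rfl, h⟩
  rw [this, csInf_singleton]

end Geometry

/-! ### Residue maps on graded algebras and key polynomials. -/

section Residual

variable {O : Type u} [CommRing O] {A : Type u} [CommRing A]

open Classical in
/-- The image of `f` in the degree `α` component of the graded algebra of `v`, read in `A`. -/
noncomputable def gradedPart (v : O[X] → ℕ∞) (c : O[X] → A) (α : ℕ) (f : O[X]) : A :=
  if v f = α then c f else 0

/-- `v` is a pseudo-valuation, and `c` induces a ring homomorphism on its graded algebra. -/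
structure IsResidual (v : O[X] → ℕ∞) (c : O[X] → A) : Prop where
  val_eq_top_iff : ∀ f, v f = ⊤ ↔ f = 0
  min_le_val_add : ∀ f f', min (v f) (v f') ≤ v (f + f')
  val_add_le_val_mul : ∀ f f', v f + v f' ≤ v (f * f')
  gradedPart_add : ∀ (α : ℕ) (f f' : O[X]), α ≤ v f → α ≤ v f' →
    gradedPart v c α (f + f') = gradedPart v c α f + gradedPart v c α f'
  gradedPart_mul : ∀ (α α' : ℕ) (f f' : O[X]), α ≤ v f → α' ≤ v f' →
    gradedPart v c (α + α') (f * f') = gradedPart v c α f * gradedPart v c α' f'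

/-- `g` is a key polynomial for the pseudo-valuation `v` with residue map `c`. -/
structure IsKey (v : O[X] → ℕ∞) (c : O[X] → A) (g : O[X]) : Prop where
  monic : g.Monic
  natDegree_pos : 0 < g.natDegree
  residue_eq_zero : c g = 0
  val_mul : ∀ f, v (g * f) = v g + v f
  residue_ne_zero : ∀ a, a ≠ 0 → a.degree < g.degree → c a ≠ 0

variable {v : O[X] → ℕ∞} {c : O[X] → A} {g : O[X]}

theorem gradedPart_of_eq {α : ℕ} {f : O[X]} (h : v f = α) : gradedPart v c α f = c f :=
  if_pos h

theorem gradedPart_of_ne {α : ℕ} {f : O[X]} (h : v f ≠ α) : gradedPart v c α f = 0 :=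
  if_neg h

namespace IsResidual

theorem val_zero (hv : IsResidual v c) : v 0 = ⊤ := (hv.val_eq_top_iff 0).2 rfl

theorem exists_val_eq (hv : IsResidual v c) {f : O[X]} (hf : f ≠ 0) : ∃ n : ℕ, v f = n := by
  have : v f ≠ ⊤ := fun h => hf ((hv.val_eq_top_iff f).1 h)
  exact ⟨_, (ENat.natCast_toNat this).symm⟩

theorem val_neg_le (hv : IsResidual v c) (f : O[X]) : v f ≤ v (-f) := by
  have := hv.val_add_le_val_mul (-1) f
  rw [neg_one_mul] at this
  exact le_add_self.trans this

theorem lt_val_add (hv : IsResidual v c) {x : ℕ∞} {f f' : O[X]} (h : x < v f) (h' : x < v f') :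
    x < v (f + f') :=
  (lt_min h h').trans_le (hv.min_le_val_add f f')

end IsResidual

namespace IsKey

theorem nontrivial (hg : IsKey v c g) : Nontrivial O := by
  by_contra h
  rw [not_nontrivial_iff_subsingleton] at h
  have h1 := hg.natDegree_pos
  rw [Subsingleton.elim g 0] at h1
  simp at h1

theorem ne_zero (hg : IsKey v c g) : g ≠ 0 := by
  rintro rfl
  have h1 := hg.natDegree_pos
  simp at h1

theorem exists_val_eq (hg : IsKey v c g) (hv : IsResidual v c) : ∃ γ : ℕ, v g = γ :=
  hv.exists_val_eq hg.ne_zero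

/-- Exact additivity of values for multiples of `g` forces the degree to split as `v g + v f`, and
then the factor `c g = 0` appears. -/
theorem gradedPart_mul_eq_zero (hg : IsKey v c g) (hv : IsResidual v c) (α : ℕ) (f : O[X]) :
    gradedPart v c α (g * f) = 0 := by
  by_cases h : v (g * f) = α
  · obtain ⟨γ, hγ⟩ := hg.exists_val_eq hv
    rcases eq_or_ne f 0 with rfl | hf
    · simp [hv.val_zero] at h
    obtain ⟨n, hn⟩ := hv.exists_val_eq hf
    have hα : α = γ + n := by
      rw [hg.val_mul, hγ, hn] at h
      exact_mod_cast h.symm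
    rw [hα, hv.gradedPart_mul γ n g f hγ.ge hn.ge, gradedPart_of_eq hγ, hg.residue_eq_zero,
      zero_mul]
  · exact gradedPart_of_ne h

/-- If the minimum `n` were exceeded, the degree `n` parts would cancel. Multiples of `g` have zero
residue, so the part of `a` would vanish too, which is impossible if `v a = n`. -/
theorem val_add_mul (hg : IsKey v c g) (hv : IsResidual v c) {a : O[X]}
    (ha : a.degree < g.degree) (q : O[X]) : v (a + g * q) = min (v a) (v (g * q)) := by
  refine le_antisymm ?_ (hv.min_le_val_add _ _)
  by_contra! hlt
  obtain ⟨n, hn⟩ : ∃ n : ℕ, min (v a) (v (g * q)) = n :=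
    ⟨_, (ENat.natCast_toNat (ne_top_of_lt hlt)).symm⟩
  have hna : (n : ℕ∞) ≤ v a := hn ▸ min_le_left _ _
  have hnq : (n : ℕ∞) ≤ v (g * q) := hn ▸ min_le_right _ _
  rw [hn] at hlt
  have h1 := hv.gradedPart_add n a (g * q) hna hnq
  rw [gradedPart_of_ne hlt.ne', hg.gradedPart_mul_eq_zero hv, add_zero] at h1
  have h2 : v a ≠ n := by
    intro h
    rw [gradedPart_of_eq h] at h1
    refine hg.residue_ne_zero a ?_ ha h1.symm
    rintro rfl
    simp [hv.val_zero] at h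
  -- Now both `a` and `g * q = (a + g * q) - a` have value above `n`, contradicting the choice of
  -- `n`.
  have h3 : (n : ℕ∞) < v a := lt_of_le_of_ne hna h2.symm
  have h4 : (n : ℕ∞) < v (g * q) := by
    have := hv.lt_val_add hlt (h3.trans_le (hv.val_neg_le a))
    simpa using this
  have := lt_min h3 h4
  rw [hn] at this
  exact lt_irrefl _ this

theorem val_mul_pow (hg : IsKey v c g) (f : O[X]) (s : ℕ) :
    v (f * g ^ s) = v f + s * v g := by
  induction s with
  | zero => simp
  | succ s ih =>
    have : f * g ^ (s + 1) = g * (f * g ^ s) := by ring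
    rw [this, hg.val_mul, ih]
    push_cast
    ring

/-- Iterates `val_add_mul` along repeated division by `g`. Applied one order higher, this is (D2).
-/
theorem isLeast_val (hg : IsKey v c g) (hv : IsResidual v c) (f : O[X]) :
    IsLeast (Set.range fun s : ℕ => v (adicCoeff g s f * g ^ s)) (v f) := by
  have := hg.nontrivial
  have step : ∀ f : O[X], v f = min (v (adicCoeff g 0 f)) (v g + v (f /ₘ g)) := fun f => by
    conv_lhs => rw [← modByMonic_add_div f g]
    rw [hg.val_add_mul hv (degree_modByMonic_lt _ hg.monic), hg.val_mul, adicCoeff_zero]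
  have succ : ∀ (f : O[X]) (s : ℕ), v (adicCoeff g (s + 1) f * g ^ (s + 1)) =
      v g + v (adicCoeff g s (f /ₘ g) * g ^ s) := fun f s => by
    rw [adicCoeff_succ, hg.val_mul_pow, hg.val_mul_pow]
    push_cast
    ring
  constructor
  · induction hn : f.natDegree using Nat.strong_induction_on generalizing f with
    | _ n ih =>
      rcases min_choice (v (adicCoeff g 0 f)) (v g + v (f /ₘ g)) with h | h
      · exact ⟨0, by simp only [pow_zero, mul_one]; rw [step f, h]⟩
      · by_cases hlt : f.natDegree < g.natDegree
        · refine ⟨0, ?_⟩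
          simp only [pow_zero, mul_one, adicCoeff_zero]
          rw [(modByMonic_eq_self_iff hg.monic).2 (degree_lt_degree hlt)]
        · obtain ⟨s, hs⟩ := ih (f /ₘ g).natDegree (by
            rw [natDegree_divByMonic f hg.monic]
            have := hg.natDegree_pos
            omega) _ rfl
          refine ⟨s + 1, ?_⟩
          simp only at hs ⊢
          rw [succ, hs, step f, h]
  · rintro _ ⟨s, rfl⟩
    simp only
    induction s generalizing f with
    | zero =>
      rw [step f, pow_zero, mul_one]
      exact min_le_left _ _
    | succ s ih =>
      rw [succ, step f]
      exact (min_le_right _ _).trans (by gcongr; exact ih _)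

end IsKey

/-! ### The homogeneous Laurent form attached to a line of slope `-lam`. -/

section Line

/-- The value `e * v(a g ^ s) + s * h` of a monomial `a g ^ s` for the slope `lam = h / e`. -/
noncomputable def lineVal (v : O[X] → ℕ∞) (g : O[X]) (lam : ℚ) (s : ℕ) (a : O[X]) : ℕ∞ :=
  (slopeDen lam : ℕ∞) * v (a * g ^ s) + (s : ℕ∞) * (slopeNum lam : ℕ∞)

open Classical in
/-- The contribution of the monomial `a g ^ s` to the line `e * y + h * x = β`. -/
noncomputable def lineCoeff (v : O[X] → ℕ∞) (c : O[X] → A) (g : O[X]) (lam : ℚ) (β s : ℕ)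
    (a : O[X]) : A :=
  if lineVal v g lam s a = β then c a else 0

/-- The exponent attached to the abscissa `s` on the line `e * y + h * x = β`. -/
def lineExp (lam : ℚ) (β s : ℕ) : ℤ := ((s : ℤ) - bezL lam * β) / (slopeDen lam : ℤ)

/-- The homogeneous residual Laurent polynomial of `f` in degree `β`. -/
noncomputable def lineForm (v : O[X] → ℕ∞) (c : O[X] → A) (g : O[X]) (lam : ℚ) (β : ℕ)
    (f : O[X]) : LaurentPolynomial A :=
  ∑ᶠ s : ℕ, LaurentPolynomial.C (lineCoeff v c g lam β s (adicCoeff g s f)) *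
    LaurentPolynomial.T (lineExp lam β s)

variable {lam : ℚ} {β β' s s' : ℕ} {a b f f' : O[X]}

theorem slopeDen_pos (lam : ℚ) : 0 < slopeDen lam := lam.den_pos

theorem slopeNum_pos (hlam : 0 < lam) : 0 < slopeNum lam := by
  have := Rat.num_pos.mpr hlam
  unfold slopeNum; omega

theorem lineCoeff_of_eq (h : lineVal v g lam s a = β) : lineCoeff v c g lam β s a = c a :=
  if_pos h

theorem lineCoeff_of_ne (h : lineVal v g lam s a ≠ β) : lineCoeff v c g lam β s a = 0 :=
  if_neg h

theorem lineVal_eq_coe (hg : IsKey v c g) {γ n : ℕ} (hγ : v g = γ) (hn : v a = n) :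
    lineVal v g lam s a =
      ((slopeDen lam * (n + s * γ) + s * slopeNum lam : ℕ) : ℕ∞) := by
  unfold lineVal
  rw [hg.val_mul_pow, hγ, hn]
  push_cast
  rfl

theorem lineVal_zero (hv : IsResidual v c) : lineVal v g lam s 0 = ⊤ := by
  unfold lineVal
  have : (slopeDen lam : ℕ∞) ≠ 0 := by exact_mod_cast (slopeDen_pos lam).ne'
  rw [zero_mul, hv.val_zero, ENat.mul_top this, top_add]

theorem lineCoeff_zero (hv : IsResidual v c) : lineCoeff v c g lam β s 0 = 0 :=
  lineCoeff_of_ne (by rw [lineVal_zero hv]; exact ENat.top_ne_natCast β)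

theorem valOf_eq (f : O[X]) : valOf v g lam f = ⨅ s, lineVal v g lam s (adicCoeff g s f) := rfl

theorem le_valOf_iff {x : ℕ∞} :
    x ≤ valOf v g lam f ↔ ∀ s, x ≤ lineVal v g lam s (adicCoeff g s f) := by
  rw [valOf_eq]; exact le_iInf_iff

theorem exists_lineVal_eq (hv : IsResidual v c)
    (h : lineVal v g lam s a = β) : ∃ n : ℕ, v a = n := by
  refine hv.exists_val_eq ?_
  rintro rfl
  rw [lineVal_zero hv] at h
  exact ENat.top_ne_natCast β h

/-- From `β = e u + s h` and `ℓ h + ℓ' e = 1` one gets `s - ℓ β = e (ℓ' s - ℓ u)`. So the division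
in `lineExp` is exact for points on the line, and at the left endpoint of a segment its value is
`ν`. -/
theorem dvd_of_lineVal_eq (hlam : 0 < lam) (hg : IsKey v c g) (hv : IsResidual v c)
    (h : lineVal v g lam s a = β) : (slopeDen lam : ℤ) ∣ (s : ℤ) - bezL lam * β := by
  obtain ⟨γ, hγ⟩ := hg.exists_val_eq hv
  obtain ⟨n, hn⟩ := exists_lineVal_eq hv h
  rw [lineVal_eq_coe hg hγ hn] at h
  have hβ : (β : ℤ) = slopeDen lam * (n + s * γ) + s * slopeNum lam := by
    exact_mod_cast (Nat.cast_injective h).symm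
  have hb := (bezout_spec lam hlam).1
  refine ⟨bezL' lam * s - bezL lam * (n + s * γ), ?_⟩
  rw [hβ]
  linear_combination (-(s : ℤ)) * hb

/-- Above a fixed abscissa the line contains at most one admissible ordinate, so `lineCoeff` is
either identically zero or the graded part of a single degree `α`. -/
theorem lineVal_cases (hg : IsKey v c g) (hv : IsResidual v c) (lam : ℚ) (β s : ℕ) :
    (∀ a, lineVal v g lam s a ≠ β) ∨
      ∃ α : ℕ, ∀ a, (lineVal v g lam s a = β ↔ v a = α) ∧ (β ≤ lineVal v g lam s a ↔ α ≤ v a) := by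
  obtain ⟨γ, hγ⟩ := hg.exists_val_eq hv
  by_cases hex : ∃ α, slopeDen lam * (α + s * γ) + s * slopeNum lam = β
  · right
    obtain ⟨α, hα⟩ := hex
    refine ⟨α, fun a => ?_⟩
    rcases eq_or_ne a 0 with rfl | ha
    · simp [lineVal_zero hv, hv.val_zero]
    obtain ⟨n, hn⟩ := hv.exists_val_eq ha
    have hpos := slopeDen_pos lam
    rw [lineVal_eq_coe hg hγ hn, hn, ← hα]
    norm_cast
    constructor
    · simp [hpos.ne']
    · simp [hpos]
  · left
    intro a h
    obtain ⟨n, hn⟩ := exists_lineVal_eq hv h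
    rw [lineVal_eq_coe hg hγ hn] at h
    exact hex ⟨n, Nat.cast_injective h⟩

theorem lineCoeff_add (hg : IsKey v c g) (hv : IsResidual v c)
    (ha : β ≤ lineVal v g lam s a) (hb : β ≤ lineVal v g lam s b) :
    lineCoeff v c g lam β s (a + b) = lineCoeff v c g lam β s a + lineCoeff v c g lam β s b := by
  rcases lineVal_cases hg hv lam β s with h | ⟨α, h⟩
  · simp only [lineCoeff_of_ne (h _), add_zero]
  · have key : ∀ a, lineCoeff v c g lam β s a = gradedPart v c α a := fun a => by
      unfold lineCoeff gradedPart
      simp only [(h a).1]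
    rw [key, key, key]
    exact hv.gradedPart_add α a b ((h a).2.1 ha) ((h b).2.1 hb)

theorem le_lineVal_add (hv : IsResidual v c) {x : ℕ∞}
    (ha : x ≤ lineVal v g lam s a) (hb : x ≤ lineVal v g lam s b) :
    x ≤ lineVal v g lam s (a + b) := by
  have h := hv.min_le_val_add (a * g ^ s) (b * g ^ s)
  rw [← add_mul] at h
  unfold lineVal at *
  rcases min_choice (v (a * g ^ s)) (v (b * g ^ s)) with h' | h' <;> rw [h'] at h
  · exact ha.trans (by gcongr)
  · exact hb.trans (by gcongr)

theorem min_le_valOf_add (hg : IsKey v c g) (hv : IsResidual v c) (f f' : O[X]) :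
    min (valOf v g lam f) (valOf v g lam f') ≤ valOf v g lam (f + f') := by
  rw [le_valOf_iff]
  intro s
  rw [adicCoeff_add hg.monic]
  exact le_lineVal_add hv ((min_le_left _ _).trans (le_valOf_iff.1 le_rfl s))
    ((min_le_right _ _).trans (le_valOf_iff.1 le_rfl s))

theorem valOf_zero (hg : IsKey v c g) (hv : IsResidual v c) : valOf v g lam 0 = ⊤ := by
  rw [eq_top_iff, le_valOf_iff]
  intro s
  rw [adicCoeff_of_zero hg.monic, lineVal_zero hv]

theorem valOf_eq_top_iff (hg : IsKey v c g) (hv : IsResidual v c) (f : O[X]) :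
    valOf v g lam f = ⊤ ↔ f = 0 := by
  refine ⟨fun h => ?_, fun h => h ▸ valOf_zero hg hv⟩
  by_contra hf
  obtain ⟨s, hs⟩ := exists_adicCoeff_ne_zero hg.monic hg.natDegree_pos hf
  obtain ⟨γ, hγ⟩ := hg.exists_val_eq hv
  obtain ⟨n, hn⟩ := hv.exists_val_eq hs
  have := le_valOf_iff.1 h.ge s
  rw [lineVal_eq_coe hg hγ hn] at this
  exact ENat.natCast_ne_top _ (top_le_iff.1 this)

/-- Guards against the default value `0` of a `finsum` with infinite support when sums are added. -/
theorem finite_support_lineForm (hg : IsKey v c g) (hv : IsResidual v c) (f : O[X]) :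
    (Function.support fun s : ℕ =>
      LaurentPolynomial.C (lineCoeff v c g lam β s (adicCoeff g s f)) *
        LaurentPolynomial.T (lineExp lam β s)).Finite := by
  refine (Set.finite_Iic f.natDegree).subset fun s hs => ?_
  by_contra hlt
  rw [Set.mem_Iic, not_le] at hlt
  apply hs
  simp only
  rw [adicCoeff_eq_zero hg.monic hg.natDegree_pos hlt, lineCoeff_zero hv, map_zero, zero_mul]

theorem lineForm_add (hg : IsKey v c g) (hv : IsResidual v c)
    (hf : β ≤ valOf v g lam f) (hf' : β ≤ valOf v g lam f') :
    lineForm v c g lam β (f + f') = lineForm v c g lam β f + lineForm v c g lam β f' := by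
  unfold lineForm
  rw [← finsum_add_distrib (finite_support_lineForm hg hv f) (finite_support_lineForm hg hv f')]
  refine finsum_congr fun s => ?_
  rw [adicCoeff_add hg.monic, lineCoeff_add hg hv (le_valOf_iff.1 hf s) (le_valOf_iff.1 hf' s),
    map_add, add_mul]

theorem lineForm_of_lt (h : β < valOf v g lam f) : lineForm v c g lam β f = 0 := by
  have : ∀ s, lineCoeff v c g lam β s (adicCoeff g s f) = 0 := fun s =>
    lineCoeff_of_ne (h.trans_le (le_valOf_iff.1 le_rfl s)).ne'
  simp [lineForm, this]

theorem lineForm_zero (hg : IsKey v c g) (hv : IsResidual v c) :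
    lineForm v c g lam β (0 : O[X]) = 0 :=
  lineForm_of_lt (by rw [valOf_zero hg hv]; exact ENat.natCast_lt_top β)

theorem valOf_mul_pow (hg : IsKey v c g) (hv : IsResidual v c) (ha : a.degree < g.degree)
    (s : ℕ) : valOf v g lam (a * g ^ s) = lineVal v g lam s a := by
  have := hg.nontrivial
  refine le_antisymm ?_ (le_valOf_iff.2 fun t => ?_)
  · have := le_valOf_iff.1 (le_refl (valOf v g lam (a * g ^ s))) s
    rwa [adicCoeff_mul_pow hg.monic ha, if_pos rfl] at this
  · rw [adicCoeff_mul_pow hg.monic ha]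
    split_ifs with h
    · rw [h]
    · rw [lineVal_zero hv]; exact le_top

theorem lineForm_mul_pow (hg : IsKey v c g) (hv : IsResidual v c) (ha : a.degree < g.degree)
    (s : ℕ) : lineForm v c g lam β (a * g ^ s) =
      LaurentPolynomial.C (lineCoeff v c g lam β s a) *
        LaurentPolynomial.T (lineExp lam β s) := by
  have := hg.nontrivial
  unfold lineForm
  rw [finsum_eq_single _ s fun t ht => ?_]
  · rw [adicCoeff_mul_pow hg.monic ha, if_pos rfl]
  · rw [adicCoeff_mul_pow hg.monic ha, if_neg ht, lineCoeff_zero hv, map_zero, zero_mul]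

/-- Integer division is not additive in general; exactness of one of the two divisions is enough. -/
theorem lineExp_add (h : (slopeDen lam : ℤ) ∣ (s : ℤ) - bezL lam * β) :
    lineExp lam (β + β') (s + s') = lineExp lam β s + lineExp lam β' s' := by
  unfold lineExp
  rw [← Int.add_ediv_of_dvd_left h]
  congr 1
  push_cast
  ring

/-- By `val_add_mul`, both the remainder `x` and `g` times the quotient have value at least `v a + v
b`. The quotient sits one abscissa further right, which adds `h > 0` and gives the strict
inequality. -/
theorem lineVal_mod_div (hlam : 0 < lam) (hg : IsKey v c g) (hv : IsResidual v c)
    (ha : β ≤ lineVal v g lam s a) (hb : β' ≤ lineVal v g lam s' b) :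
    lineVal v g lam s a + lineVal v g lam s' b ≤ lineVal v g lam (s + s') ((a * b) %ₘ g) ∧
      ((β + β' : ℕ) : ℕ∞) < lineVal v g lam (s + s' + 1) ((a * b) /ₘ g) := by
  have := hg.nontrivial
  obtain ⟨γ, hγ⟩ := hg.exists_val_eq hv
  rcases eq_or_ne a 0 with rfl | ha0
  · simp only [zero_mul, zero_modByMonic, zero_divByMonic, lineVal_zero hv]
    exact ⟨le_top, ENat.natCast_lt_top _⟩
  rcases eq_or_ne b 0 with rfl | hb0
  · simp only [mul_zero, zero_modByMonic, zero_divByMonic, lineVal_zero hv]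
    exact ⟨le_top, ENat.natCast_lt_top _⟩
  obtain ⟨i, hi⟩ := hv.exists_val_eq ha0
  obtain ⟨j, hj⟩ := hv.exists_val_eq hb0
  have hab := hv.val_add_le_val_mul a b
  rw [← modByMonic_add_div (a * b) g,
    hg.val_add_mul hv (degree_modByMonic_lt _ hg.monic), hi, hj, le_min_iff, hg.val_mul, hγ] at hab
  rw [lineVal_eq_coe hg hγ hi, Nat.cast_le] at ha
  rw [lineVal_eq_coe hg hγ hj, Nat.cast_le] at hb
  rw [lineVal_eq_coe hg hγ hi, lineVal_eq_coe hg hγ hj]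
  have hn := slopeNum_pos hlam
  constructor
  · rcases eq_or_ne ((a * b) %ₘ g) 0 with h0 | h0
    · rw [h0, lineVal_zero hv]; exact le_top
    obtain ⟨k, hk⟩ := hv.exists_val_eq h0
    rw [hk] at hab
    rw [lineVal_eq_coe hg hγ hk]
    have h1 : i + j ≤ k := by exact_mod_cast hab.1
    norm_cast
    have := Nat.mul_le_mul_left (slopeDen lam) h1
    ring_nf at this ⊢
    omega
  · rcases eq_or_ne ((a * b) /ₘ g) 0 with h0 | h0
    · rw [h0, lineVal_zero hv]; exact ENat.natCast_lt_top _
    obtain ⟨k, hk⟩ := hv.exists_val_eq h0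
    rw [hk] at hab
    rw [lineVal_eq_coe hg hγ hk]
    have h1 : i + j ≤ γ + k := by exact_mod_cast hab.2
    norm_cast
    have := Nat.mul_le_mul_left (slopeDen lam) h1
    ring_nf at this ha hb ⊢
    omega

/-- If both monomials are on their lines, multiplicativity of graded parts applies to `a * b`, whose
multiple-of-`g` part contributes nothing. If one is strictly above, the remainder is strictly above
the sum line and both sides vanish. -/
theorem lineCoeff_mod (hlam : 0 < lam) (hg : IsKey v c g) (hv : IsResidual v c)
    (ha : β ≤ lineVal v g lam s a) (hb : β' ≤ lineVal v g lam s' b) :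
    lineCoeff v c g lam (β + β') (s + s') ((a * b) %ₘ g) =
      lineCoeff v c g lam β s a * lineCoeff v c g lam β' s' b := by
  have := hg.nontrivial
  have hle := (lineVal_mod_div hlam hg hv ha hb).1
  by_cases hae : lineVal v g lam s a = β
  · by_cases hbe : lineVal v g lam s' b = β'
    · obtain ⟨γ, hγ⟩ := hg.exists_val_eq hv
      obtain ⟨i, hi⟩ := exists_lineVal_eq hv hae
      obtain ⟨j, hj⟩ := exists_lineVal_eq hv hbe
      have hab := hv.val_add_le_val_mul a b
      rw [hi, hj] at hab
      have hab' := hab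
      rw [← modByMonic_add_div (a * b) g,
        hg.val_add_mul hv (degree_modByMonic_lt _ hg.monic), le_min_iff] at hab
      have hm := hv.gradedPart_mul i j a b hi.ge hj.ge
      rw [← modByMonic_add_div (a * b) g, hv.gradedPart_add (i + j) _ _ (by exact_mod_cast hab.1)
        (by exact_mod_cast hab.2), hg.gradedPart_mul_eq_zero hv, add_zero, gradedPart_of_eq hi,
        gradedPart_of_eq hj] at hm
      rw [lineCoeff_of_eq hae, lineCoeff_of_eq hbe, ← hm]
      rw [lineVal_eq_coe hg hγ hi] at hae
      rw [lineVal_eq_coe hg hγ hj] at hbe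
      have hae' := Nat.cast_injective hae
      have hbe' := Nat.cast_injective hbe
      unfold lineCoeff gradedPart
      have hiff : lineVal v g lam (s + s') ((a * b) %ₘ g) = ((β + β' : ℕ) : ℕ∞) ↔
          v ((a * b) %ₘ g) = ((i + j : ℕ) : ℕ∞) := by
        rcases eq_or_ne ((a * b) %ₘ g) 0 with h0 | h0
        · rw [h0, lineVal_zero hv, hv.val_zero]
          exact iff_of_false (ENat.top_ne_natCast _) (ENat.top_ne_natCast _)
        · obtain ⟨k, hk⟩ := hv.exists_val_eq h0
          rw [lineVal_eq_coe hg hγ hk, hk, Nat.cast_inj, Nat.cast_inj, ← hae', ← hbe']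
          have hpos := slopeDen_pos lam
          constructor
          · intro h
            apply Nat.eq_of_mul_eq_mul_left hpos
            ring_nf at h ⊢
            omega
          · rintro rfl
            ring
      simp only [hiff]
    · rw [lineCoeff_of_ne hbe, mul_zero]
      apply lineCoeff_of_ne
      refine (lt_of_lt_of_le ?_ hle).ne'
      push_cast
      exact ENat.add_lt_add_of_le_of_lt (ENat.natCast_ne_top _) ha (lt_of_le_of_ne hb (Ne.symm hbe))
  · rw [lineCoeff_of_ne hae, zero_mul]
    apply lineCoeff_of_ne
    refine (lt_of_lt_of_le ?_ hle).ne'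
    push_cast
    exact ENat.add_lt_add_of_lt_of_le (ENat.natCast_ne_top _) (lt_of_le_of_ne ha (Ne.symm hae)) hb

theorem lineForm_mul_monomial (hlam : 0 < lam) (hg : IsKey v c g) (hv : IsResidual v c)
    (hda : a.degree < g.degree) (hdb : b.degree < g.degree)
    (ha : β ≤ lineVal v g lam s a) (hb : β' ≤ lineVal v g lam s' b) :
    ((β + β' : ℕ) : ℕ∞) ≤ valOf v g lam (a * g ^ s * (b * g ^ s')) ∧
      lineForm v c g lam (β + β') (a * g ^ s * (b * g ^ s')) =
        lineForm v c g lam β (a * g ^ s) * lineForm v c g lam β' (b * g ^ s') := by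
  have := hg.nontrivial
  have hsplit : a * g ^ s * (b * g ^ s') =
      ((a * b) %ₘ g) * g ^ (s + s') + ((a * b) /ₘ g) * g ^ (s + s' + 1) := by
    have := modByMonic_add_div (a * b) g
    linear_combination (-(g ^ (s + s'))) * this
  have hr := degree_modByMonic_lt (a * b) hg.monic
  -- Since `deg a + deg b < 2 deg g`, the splitting above is already a canonical expansion with two
  -- terms.
  have hq : ((a * b) /ₘ g).degree < g.degree := by
    rcases eq_or_ne a 0 with rfl | ha0
    · rw [zero_mul, zero_divByMonic, degree_zero]
      exact bot_lt_iff_ne_bot.2 (degree_ne_bot.2 hg.ne_zero)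
    · apply degree_lt_degree
      rw [natDegree_divByMonic _ hg.monic]
      have h1 := natDegree_mul_le (p := a) (q := b)
      have h2 := natDegree_lt_natDegree ha0 hda
      have h3 := hg.natDegree_pos
      have h4 : b.natDegree < g.natDegree ∨ b = 0 := by
        rcases eq_or_ne b 0 with h | h
        · exact Or.inr h
        · exact Or.inl (natDegree_lt_natDegree h hdb)
      rcases h4 with h4 | rfl
      · omega
      · simp [h3]
  obtain ⟨h1, h2⟩ := lineVal_mod_div hlam hg hv ha hb
  have h1' : ((β + β' : ℕ) : ℕ∞) ≤ valOf v g lam (((a * b) %ₘ g) * g ^ (s + s')) := by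
    rw [valOf_mul_pow hg hv hr]
    refine le_trans ?_ h1
    push_cast
    exact add_le_add ha hb
  have h2' : ((β + β' : ℕ) : ℕ∞) < valOf v g lam (((a * b) /ₘ g) * g ^ (s + s' + 1)) := by
    rwa [valOf_mul_pow hg hv hq]
  rw [hsplit]
  refine ⟨(le_min h1' h2'.le).trans (min_le_valOf_add hg hv _ _), ?_⟩
  rw [lineForm_add hg hv h1' h2'.le, lineForm_of_lt h2', add_zero, lineForm_mul_pow hg hv hr,
    lineForm_mul_pow hg hv hda, lineForm_mul_pow hg hv hdb, lineCoeff_mod hlam hg hv ha hb]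
  -- Additivity of exponents needs `a` on its line; otherwise both coefficients are zero.
  by_cases hae : lineVal v g lam s a = β
  · rw [lineExp_add (dvd_of_lineVal_eq hlam hg hv hae), LaurentPolynomial.T_add, map_mul]
    ring
  · rw [lineCoeff_of_ne hae]
    simp

theorem lineForm_mul (hlam : 0 < lam) (hg : IsKey v c g) (hv : IsResidual v c)
    (hf : β ≤ valOf v g lam f) (hf' : β' ≤ valOf v g lam f') :
    ((β + β' : ℕ) : ℕ∞) ≤ valOf v g lam (f * f') ∧
      lineForm v c g lam (β + β') (f * f') =
        lineForm v c g lam β f * lineForm v c g lam β' f' := by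
  have := hg.nontrivial
  -- Reduction to monomials. The bound `x` travels along because `lineForm` is additive only on
  -- polynomials of value at least its degree.
  have induct : ∀ (x : ℕ) (p : O[X]) (Q : O[X] → Prop), x ≤ valOf v g lam p → Q 0 →
      (∀ p₁ p₂, x ≤ valOf v g lam p₁ → x ≤ valOf v g lam p₂ → Q p₁ → Q p₂ → Q (p₁ + p₂)) →
      (∀ s, Q (adicCoeff g s p * g ^ s)) → Q p := by
    intro x p Q hp h0 hadd hmon
    rw [← sum_adicCoeff_mul_pow hg.monic hg.natDegree_pos (Nat.lt_succ_self p.natDegree)]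
    refine (Finset.sum_induction _ (fun p => x ≤ valOf v g lam p ∧ Q p) ?_ ?_ ?_).2
    · rintro p₁ p₂ ⟨h1, h1'⟩ ⟨h2, h2'⟩
      exact ⟨(le_min h1 h2).trans (min_le_valOf_add hg hv _ _), hadd _ _ h1 h2 h1' h2'⟩
    · exact ⟨by rw [valOf_zero hg hv]; exact le_top, h0⟩
    · intro s _
      refine ⟨?_, hmon s⟩
      rw [valOf_mul_pow hg hv (degree_adicCoeff_lt hg.monic s p)]
      exact le_valOf_iff.1 hp s
  refine induct β f (fun f => ((β + β' : ℕ) : ℕ∞) ≤ valOf v g lam (f * f') ∧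
      lineForm v c g lam (β + β') (f * f') =
        lineForm v c g lam β f * lineForm v c g lam β' f') hf ?_ ?_ fun s => ?_
  · simp [valOf_zero hg hv, lineForm_zero hg hv]
  · rintro p₁ p₂ h1 h2 ⟨h1', h1''⟩ ⟨h2', h2''⟩
    rw [add_mul]
    refine ⟨(le_min h1' h2').trans (min_le_valOf_add hg hv _ _), ?_⟩
    rw [lineForm_add hg hv h1' h2', lineForm_add hg hv h1 h2, h1'', h2'', add_mul]
  · refine induct β' f' (fun f' =>
      ((β + β' : ℕ) : ℕ∞) ≤ valOf v g lam (adicCoeff g s f * g ^ s * f') ∧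
      lineForm v c g lam (β + β') (adicCoeff g s f * g ^ s * f') =
        lineForm v c g lam β (adicCoeff g s f * g ^ s) * lineForm v c g lam β' f') hf' ?_ ?_
        fun s' => ?_
    · simp [valOf_zero hg hv, lineForm_zero hg hv]
    · rintro p₁ p₂ h1 h2 ⟨h1', h1''⟩ ⟨h2', h2''⟩
      rw [mul_add]
      refine ⟨(le_min h1' h2').trans (min_le_valOf_add hg hv _ _), ?_⟩
      rw [lineForm_add hg hv h1' h2', lineForm_add hg hv h1 h2, h1'', h2'', mul_add]
    · exact lineForm_mul_monomial hlam hg hv (degree_adicCoeff_lt hg.monic s f)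
        (degree_adicCoeff_lt hg.monic s' f') (le_valOf_iff.1 hf s) (le_valOf_iff.1 hf' s')

end Line

end Residual

/-! ### Segments, residual polynomials and their relation to the Laurent form. -/

section Edge

variable {O : Type u} [CommRing O] {A : Type u} [CommRing A]
  {v : O[X] → ℕ∞} {c : O[X] → A} {g : O[X]} {lam : ℚ} {β β' s s₀ d : ℕ} {f f' : O[X]}

/-- The segment of `f` lies on the line `e * y + h * x = β`, starts at the abscissa `s₀` and has
`d + 1` lattice points; the residual polynomial has degree `d`, and it is obtained from the
homogeneous residual Laurent polynomial by removing a power of the variable. -/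
structure IsEdge (v : O[X] → ℕ∞) (c : O[X] → A) (g : O[X]) (lam : ℚ) (f : O[X])
    (β s₀ d : ℕ) : Prop where
  valOf_eq : valOf v g lam f = β
  segmentOf_eq : segmentOf v g lam f =
    lineSegment lam ((β : ℝ) / slopeDen lam) s₀ ((s₀ + d * slopeDen lam : ℕ) : ℝ)
  nuOf_eq : (s₀ : ℤ) = slopeDen lam * nuOf v g lam f + bezL lam * β
  lineForm_eq : lineForm v c g lam β f =
    LaurentPolynomial.T (nuOf v g lam f) * toLaurent (resPolyOf v c g lam f)
  natDegree_eq : (resPolyOf v c g lam f).natDegree = d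
  coeff_zero_eq : (resPolyOf v c g lam f).coeff 0 = c (adicCoeff g s₀ f)
  leadingCoeff_eq : (resPolyOf v c g lam f).leadingCoeff =
    c (adicCoeff g (s₀ + d * slopeDen lam) f)
  left_ne_zero : adicCoeff g s₀ f ≠ 0
  right_ne_zero : adicCoeff g (s₀ + d * slopeDen lam) f ≠ 0

theorem cast_slope (hlam : 0 < lam) : (lam : ℝ) = (slopeNum lam : ℝ) / slopeDen lam := by
  have h1 : ((slopeNum lam : ℕ) : ℤ) = lam.num := by
    have := Rat.num_pos.mpr hlam
    unfold slopeNum; omega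
  have h2 : (lam : ℚ) = (slopeNum lam : ℚ) / slopeDen lam := by
    conv_lhs => rw [← Rat.num_div_den lam]
    rw [← h1]; rfl
  conv_lhs => rw [h2]
  push_cast
  rfl

theorem mem_line_iff (hlam : 0 < lam) (u s β : ℕ) :
    (u : ℝ) + lam * s = (β : ℝ) / slopeDen lam ↔ slopeDen lam * u + s * slopeNum lam = β := by
  have he : (0 : ℝ) < slopeDen lam := by exact_mod_cast slopeDen_pos lam
  rw [cast_slope hlam, ← @Nat.cast_inj ℝ, eq_div_iff he.ne']
  push_cast
  constructor <;> intro h <;> rw [← h] <;> field_simp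

theorem above_line_iff (hlam : 0 < lam) (u s β : ℕ) :
    (β : ℝ) / slopeDen lam ≤ (u : ℝ) + lam * s ↔ β ≤ slopeDen lam * u + s * slopeNum lam := by
  have he : (0 : ℝ) < slopeDen lam := by exact_mod_cast slopeDen_pos lam
  rw [cast_slope hlam, ← @Nat.cast_le ℝ, div_le_iff₀ he]
  push_cast
  have : ((u : ℝ) + slopeNum lam / slopeDen lam * s) * slopeDen lam =
      slopeDen lam * u + s * slopeNum lam := by field_simp
  rw [this]

theorem lineVal_of_val_eq {a : O[X]} {u : ℕ} (h : v (a * g ^ s) = u) :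
    lineVal v g lam s a = ((slopeDen lam * u + s * slopeNum lam : ℕ) : ℕ∞) := by
  unfold lineVal; rw [h]; push_cast; rfl

theorem exists_val_mul_pow_eq (hg : IsKey v c g) (hv : IsResidual v c) {a : O[X]} (ha : a ≠ 0)
    (s : ℕ) : ∃ u : ℕ, v (a * g ^ s) = u :=
  hv.exists_val_eq fun h => ha (by rwa [(hg.monic.pow s).mul_left_eq_zero_iff] at h)

/-- Dictionary between geometry and algebra. With `β = v_r(f)` the line supports the cloud; the
abscissas of the cloud points on it form a finite nonempty set, congruent modulo `e`, whose extremes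
are the ends of the segment. The end coefficients have nonzero residue, so the residual polynomial
has degree exactly `d` and nonzero constant term. -/
theorem exists_isEdge (hlam : 0 < lam) (hg : IsKey v c g) (hv : IsResidual v c) (hf : f ≠ 0) :
    ∃ β s₀ d, IsEdge v c g lam f β s₀ d := by
  classical
  have := hg.nontrivial
  have he := slopeDen_pos lam
  obtain ⟨β, hβ⟩ : ∃ β : ℕ, valOf v g lam f = β :=
    ⟨_, (ENat.natCast_toNat fun h => hf ((valOf_eq_top_iff hg hv f).1 h)).symm⟩
  have hge : ∀ s, (β : ℕ∞) ≤ lineVal v g lam s (adicCoeff g s f) := le_valOf_iff.1 hβ.ge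
  have hne : ∀ s, lineVal v g lam s (adicCoeff g s f) = β → adicCoeff g s f ≠ 0 := by
    intro s hs h0
    rw [h0, lineVal_zero hv] at hs
    exact ENat.top_ne_natCast _ hs
  let S := (Finset.range (f.natDegree + 1)).filter
    fun s => lineVal v g lam s (adicCoeff g s f) = β
  have hS : ∀ s, s ∈ S ↔ lineVal v g lam s (adicCoeff g s f) = β := by
    intro s
    simp only [S, Finset.mem_filter, Finset.mem_range, and_iff_right_iff_imp]
    intro hs
    by_contra hlt
    exact hne s hs (adicCoeff_eq_zero hg.monic hg.natDegree_pos (by omega))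
  have hSne : S.Nonempty := by
    obtain ⟨s, hs⟩ := csInf_mem (Set.range_nonempty fun s => lineVal v g lam s (adicCoeff g s f))
    exact ⟨s, (hS s).2 (hs.trans hβ)⟩
  obtain ⟨s₀, hs₀, hmin⟩ : ∃ s₀ ∈ S, ∀ s ∈ S, s₀ ≤ s :=
    ⟨S.min' hSne, S.min'_mem hSne, fun s hs => S.min'_le s hs⟩
  obtain ⟨s₁, hs₁, hmax⟩ : ∃ s₁ ∈ S, ∀ s ∈ S, s ≤ s₁ :=
    ⟨S.max' hSne, S.max'_mem hSne, fun s hs => S.le_max' s hs⟩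
  -- All these abscissas are congruent to `ℓ β` modulo `e`, so their differences are multiples of
  -- `e`.
  have hstep : ∀ s ∈ S, ∃ j, s = s₀ + j * slopeDen lam := by
    intro s hs
    have h1 := dvd_of_lineVal_eq hlam hg hv ((hS s).1 hs)
    have h2 := dvd_of_lineVal_eq hlam hg hv ((hS s₀).1 hs₀)
    have h3 := dvd_sub h1 h2
    rw [sub_sub_sub_cancel_right] at h3
    have h4 := hmin s hs
    rw [← Nat.cast_sub h4, Int.natCast_dvd_natCast] at h3
    obtain ⟨j, hj⟩ := h3
    exact ⟨j, by rw [mul_comm]; omega⟩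
  obtain ⟨d, rfl⟩ := hstep s₁ hs₁
  have hl₀ := (hS _).1 hs₀
  have hl₁ := (hS _).1 hs₁
  obtain ⟨u₀, hu₀⟩ := exists_val_mul_pow_eq hg hv (hne _ hl₀) s₀
  obtain ⟨u₁, hu₁⟩ := exists_val_mul_pow_eq hg hv (hne _ hl₁) (s₀ + d * slopeDen lam)
  have hon : ∀ s u : ℕ, v (adicCoeff g s f * g ^ s) = u →
      ((u : ℝ) + lam * s = (β : ℝ) / slopeDen lam ↔ s ∈ S) := by
    intro s u hu
    rw [mem_line_iff hlam, hS, lineVal_of_val_eq hu, Nat.cast_inj]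
  have hP₀ : ((s₀ : ℝ), (u₀ : ℝ)) ∈ cloud v g f := ⟨s₀, u₀, hne _ hl₀, hu₀, rfl⟩
  have hP₁ : (((s₀ + d * slopeDen lam : ℕ) : ℝ), (u₁ : ℝ)) ∈ cloud v g f :=
    ⟨_, u₁, hne _ hl₁, hu₁, rfl⟩
  have hL₀ := (hon _ _ hu₀).2 hs₀
  have hL₁ := (hon _ _ hu₁).2 hs₁
  have hab : ∀ p ∈ cloud v g f, (β : ℝ) / slopeDen lam ≤ p.2 + lam * p.1 := by
    rintro _ ⟨s, u, hs, hu, rfl⟩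
    rw [above_line_iff hlam]
    have := hge s
    rw [lineVal_of_val_eq hu] at this
    exact_mod_cast this
  have hbd : ∀ p ∈ cloud v g f, p.2 + (lam : ℝ) * p.1 = (β : ℝ) / slopeDen lam →
      (s₀ : ℝ) ≤ p.1 ∧ p.1 ≤ ((s₀ + d * slopeDen lam : ℕ) : ℝ) := by
    rintro _ ⟨s, u, hs, hu, rfl⟩ h
    have := (hon _ _ hu).1 h
    exact ⟨Nat.cast_le.2 (hmin s this), Nat.cast_le.2 (hmax s this)⟩
  have hle : (s₀ : ℝ) ≤ ((s₀ + d * slopeDen lam : ℕ) : ℝ) := Nat.cast_le.2 (Nat.le_add_right _ _)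
  have hseg : segmentOf v g lam f =
      lineSegment lam ((β : ℝ) / slopeDen lam) s₀ ((s₀ + d * slopeDen lam : ℕ) : ℝ) :=
    component_lowerHull hP₀ hP₁ hL₀ hL₁ hab hbd
  have hleft : leftAbscissa (segmentOf v g lam f) = s₀ := by
    rw [hseg, leftAbscissa_lineSegment hle hL₀]
  have hright : rightAbscissa (segmentOf v g lam f) = s₀ + d * slopeDen lam := by
    rw [hseg, rightAbscissa_lineSegment hle hL₁]
  have hord : leftOrdinate (segmentOf v g lam f) = u₀ := by
    rw [hseg, leftOrdinate_lineSegment hle hL₀]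
  have hnu : (s₀ : ℤ) = slopeDen lam * nuOf v g lam f + bezL lam * β := by
    unfold nuOf
    rw [hleft, hord]
    have hβ' := (mem_line_iff hlam u₀ s₀ β).1 hL₀
    have hβ'' : (β : ℤ) = slopeDen lam * u₀ + s₀ * slopeNum lam := by exact_mod_cast hβ'.symm
    rw [hβ'']
    linear_combination (-(s₀ : ℤ)) * (bezout_spec lam hlam).1
  have hlamR : (0 : ℝ) < lam := by exact_mod_cast hlam
  -- Within the range of the segment, lying on the principal polygon means lying on the line.
  have hres : ∀ s, s₀ ≤ s → s ≤ s₀ + d * slopeDen lam →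
      resCoeff v c g f s = lineCoeff v c g lam β s (adicCoeff g s f) := by
    intro s h1 h2
    have hprin : ∀ n : ℕ, adicCoeff g s f ≠ 0 → v (adicCoeff g s f * g ^ s) = n →
        (((s : ℝ), (n : ℝ)) ∈ principalPart (newtonPolygon v g f) ↔ s ∈ S) := by
      intro n hs hn
      rw [← hon s n hn]
      exact mem_principalPart_iff hlamR hP₀ hP₁ hL₀ hL₁ hab ⟨s, n, hs, hn, rfl⟩
        (Nat.cast_le.2 h1) (Nat.cast_le.2 h2)
    have hiff : (∃ n : ℕ, v (adicCoeff g s f * g ^ s) = n ∧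
        ((s : ℝ), (n : ℝ)) ∈ principalPart (newtonPolygon v g f)) ↔
        lineVal v g lam s (adicCoeff g s f) = β := by
      rw [← hS s]
      refine ⟨?_, fun hs => ?_⟩
      · rintro ⟨n, hn, hmem⟩
        refine (hprin n ?_ hn).1 hmem
        intro h0
        rw [h0, zero_mul, hv.val_zero] at hn
        exact ENat.top_ne_natCast _ hn
      · have h0 := hne s ((hS s).1 hs)
        obtain ⟨n, hn⟩ := exists_val_mul_pow_eq hg hv h0 s
        exact ⟨n, hn, (hprin n h0 hn).2 hs⟩
    unfold resCoeff lineCoeff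
    simp only [hiff]
  have hR : resPolyOf v c g lam f = ∑ j ∈ Finset.range (d + 1),
      C (lineCoeff v c g lam β (s₀ + j * slopeDen lam)
        (adicCoeff g (s₀ + j * slopeDen lam) f)) * X ^ j := by
    unfold resPolyOf
    rw [hleft, hright, Nat.add_sub_cancel_left, Nat.mul_div_cancel _ he]
    refine Finset.sum_congr rfl fun j hj => ?_
    rw [hres _ (Nat.le_add_right _ _)]
    have : j ≤ d := by have := Finset.mem_range.1 hj; omega
    have := Nat.mul_le_mul_right (slopeDen lam) this
    omega
  have hcoeff : ∀ j, (resPolyOf v c g lam f).coeff j = if j < d + 1 then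
      lineCoeff v c g lam β (s₀ + j * slopeDen lam) (adicCoeff g (s₀ + j * slopeDen lam) f)
      else 0 := by
    intro j
    rw [hR, finsetSum_coeff]
    simp only [coeff_C_mul_X_pow, Finset.sum_ite_eq, Finset.mem_range]
  have hc0 : (resPolyOf v c g lam f).coeff 0 = c (adicCoeff g s₀ f) := by
    rw [hcoeff, if_pos (Nat.succ_pos d), zero_mul, add_zero, lineCoeff_of_eq hl₀]
  have hcd : (resPolyOf v c g lam f).coeff d = c (adicCoeff g (s₀ + d * slopeDen lam) f) := by
    rw [hcoeff, if_pos (Nat.lt_succ_self d), lineCoeff_of_eq hl₁]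
  have hdeg : (resPolyOf v c g lam f).natDegree = d := by
    refine natDegree_eq_of_le_of_coeff_ne_zero ?_ ?_
    · rw [natDegree_le_iff_coeff_eq_zero]
      intro j hj
      rw [hcoeff, if_neg (by omega)]
    · rw [hcd]
      exact hg.residue_ne_zero _ (hne _ hl₁) (degree_adicCoeff_lt hg.monic _ _)
  refine ⟨β, s₀, d, hβ, hseg, hnu, ?_, hdeg, hc0, ?_, hne _ hl₀, hne _ hl₁⟩
  · rw [hR, map_sum, Finset.mul_sum]
    unfold lineForm
    rw [finsum_eq_sum_of_support_subset (s := (Finset.range (d + 1)).image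
      fun j => s₀ + j * slopeDen lam)]
    · rw [Finset.sum_image]
      · refine Finset.sum_congr rfl fun j _ => ?_
        have hexp : lineExp lam β (s₀ + j * slopeDen lam) = nuOf v g lam f + j := by
          unfold lineExp
          push_cast
          rw [hnu]
          apply Int.ediv_eq_of_eq_mul_right (by exact_mod_cast he.ne')
          ring
        rw [toLaurent_C_mul_X_pow, hexp, LaurentPolynomial.T_add]
        ring
      · intro i _ j _ hij
        exact Nat.eq_of_mul_eq_mul_right he (Nat.add_left_cancel hij)
    · intro s hs
      have hmem : s ∈ S := by
        by_contra h
        apply hs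
        simp only
        rw [lineCoeff_of_ne (mt (hS s).2 h), map_zero, zero_mul]
      obtain ⟨j, rfl⟩ := hstep s hmem
      have h1 := hmax _ hmem
      have h2 : j ≤ d := Nat.le_of_mul_le_mul_right (Nat.le_of_add_le_add_left h1) he
      simp only [Finset.coe_image, Set.mem_image, Finset.coe_range, Set.mem_Iio]
      exact ⟨j, by omega, rfl⟩
  · rw [leadingCoeff, hdeg, hcd]

/-- A nonzero constant term makes the power of `T` the lowest exponent of the Laurent polynomial, so
the factorisation is unique over any ring. -/
theorem T_mul_toLaurent_injective {p q : A[X]} {a b : ℤ} (hp : p.coeff 0 ≠ 0)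
    (hq : q.coeff 0 ≠ 0)
    (h : LaurentPolynomial.T a * toLaurent p = LaurentPolynomial.T b * toLaurent q) :
    a = b ∧ p = q := by
  wlog hab : a ≤ b generalizing a b p q
  · obtain ⟨h1, h2⟩ := this hq hp h.symm (by omega)
    exact ⟨h1.symm, h2.symm⟩
  obtain ⟨k, rfl⟩ := Int.le.dest hab
  have h1 : p = X ^ k * q := by
    apply toLaurent_injective
    rw [map_mul, toLaurent_X_pow]
    apply (LaurentPolynomial.isUnit_T a).mul_left_cancel
    rw [h, LaurentPolynomial.T_add, mul_assoc]
  rcases Nat.eq_zero_or_pos k with rfl | hk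
  · exact ⟨by simp, by simpa using h1⟩
  · rw [h1, coeff_X_pow_mul', if_neg (by omega)] at hp
    exact absurd rfl hp

theorem T_mul_toLaurent_ne_zero {p : A[X]} (hp : p ≠ 0) (n : ℤ) :
    (LaurentPolynomial.T n * toLaurent p : LaurentPolynomial A) ≠ 0 := by
  intro h
  rw [(LaurentPolynomial.isUnit_T n).mul_right_eq_zero, toLaurent_eq_zero] at h
  exact hp h

namespace IsEdge

theorem coeff_zero_ne_zero (hg : IsKey v c g) (h : IsEdge v c g lam f β s₀ d) :
    (resPolyOf v c g lam f).coeff 0 ≠ 0 := by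
  have := hg.nontrivial
  rw [h.coeff_zero_eq]
  exact hg.residue_ne_zero _ h.left_ne_zero (degree_adicCoeff_lt hg.monic _ _)

theorem resPolyOf_ne_zero (hg : IsKey v c g) (h : IsEdge v c g lam f β s₀ d) :
    resPolyOf v c g lam f ≠ 0 := by
  intro h0
  have := h.coeff_zero_ne_zero hg
  rw [h0] at this
  exact this (coeff_zero 0)

theorem mem_segmentOf (h : IsEdge v c g lam f β s₀ d) :
    ((s₀ : ℝ), (β : ℝ) / slopeDen lam - lam * s₀) ∈ segmentOf v g lam f := by
  rw [h.segmentOf_eq]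
  exact ⟨by simp, le_rfl, Nat.cast_le.2 (Nat.le_add_right _ _)⟩

end IsEdge

/-- Injectivity on each graded piece: at `β = v_r(f)` the form is a power of `T` times a nonzero
residual polynomial. -/
theorem lt_valOf_of_lineForm_eq_zero (hlam : 0 < lam) (hg : IsKey v c g) (hv : IsResidual v c)
    (hβ : β ≤ valOf v g lam f) (h : lineForm v c g lam β f = 0) : β < valOf v g lam f := by
  refine lt_of_le_of_ne hβ fun heq => ?_
  have hf : f ≠ 0 := by
    rintro rfl
    rw [valOf_zero hg hv] at heq
    exact ENat.top_ne_natCast _ heq.symm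
  obtain ⟨β', s₀, d, hE⟩ := exists_isEdge hlam hg hv hf
  rw [hE.valOf_eq, Nat.cast_inj] at heq
  rw [heq, hE.lineForm_eq] at h
  exact T_mul_toLaurent_ne_zero (hE.resPolyOf_ne_zero hg) _ h

/-- The edge of a polynomial is determined by its value and its Laurent polynomial. -/
theorem IsEdge.eq_of_lineForm_eq (hg : IsKey v c g) {s₀' d' : ℕ} (h : IsEdge v c g lam f β s₀ d)
    (h' : IsEdge v c g lam f' β s₀' d')
    (heq : lineForm v c g lam β f = lineForm v c g lam β f') :
    segmentOf v g lam f = segmentOf v g lam f' ∧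
      resPolyOf v c g lam f = resPolyOf v c g lam f' := by
  rw [h.lineForm_eq, h'.lineForm_eq] at heq
  obtain ⟨hn, hR⟩ := T_mul_toLaurent_injective (h.coeff_zero_ne_zero hg)
    (h'.coeff_zero_ne_zero hg) heq
  have hs : s₀ = s₀' := by
    have := h.nuOf_eq
    rw [hn, ← h'.nuOf_eq] at this
    exact_mod_cast this
  have hd : d = d' := by rw [← h.natDegree_eq, hR, h'.natDegree_eq]
  exact ⟨by rw [h.segmentOf_eq, h'.segmentOf_eq, hs, hd], hR⟩

theorem newtonPolygon_zero (hg : IsKey v c g) : newtonPolygon v g (0 : O[X]) = ∅ := by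
  have : cloud v g (0 : O[X]) = ∅ := by
    ext p
    simp only [cloud, Set.mem_ofPred_eq, Set.mem_empty_iff_false, iff_false]
    rintro ⟨s, n, h, -⟩
    exact h (adicCoeff_of_zero hg.monic s)
  ext p
  simp only [newtonPolygon, lowerHull, this, Set.mem_ofPred_eq, Set.mem_empty_iff_false,
    iff_false, convexHull_empty]
  tauto

theorem segmentOf_zero (hg : IsKey v c g) : segmentOf v g lam (0 : O[X]) = ∅ := by
  unfold segmentOf
  rw [newtonPolygon_zero hg]
  exact Set.eq_empty_of_forall_notMem fun p hp => hp.1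

theorem resPolyOf_zero (hg : IsKey v c g) : resPolyOf v c g lam (0 : O[X]) = 0 := by
  unfold resPolyOf
  refine Finset.sum_eq_zero fun j _ => ?_
  have : ∀ s, resCoeff v c g (0 : O[X]) s = 0 := fun s => by
    unfold resCoeff
    rw [if_neg]
    rintro ⟨n, -, h⟩
    rw [newtonPolygon_zero hg] at h
    exact h.1
  rw [this, map_zero, zero_mul]

/-- Equivalence means equal `lineForm` in degree `v_r(f)`. That form and `β` carry the same
information as the segment and the residual polynomial. -/
theorem vEquiv_iff (hlam : 0 < lam) (hg : IsKey v c g) (hv : IsResidual v c) (hf : f ≠ 0) :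
    VEquiv (valOf v g lam) f f' ↔ segmentOf v g lam f = segmentOf v g lam f' ∧
      resPolyOf v c g lam f = resPolyOf v c g lam f' := by
  obtain ⟨β, s₀, d, hE⟩ := exists_isEdge hlam hg hv hf
  have hβ := hE.valOf_eq
  -- Obtained by multiplying with `-1`, viewed as an element of value at least `0`.
  have neg_le : ∀ p : O[X], valOf v g lam p ≤ valOf v g lam (-p) := by
    intro p
    rcases eq_or_ne p 0 with rfl | hp
    · rw [neg_zero]
    obtain ⟨b, hb⟩ : ∃ b : ℕ, valOf v g lam p = b :=
      ⟨_, (ENat.natCast_toNat fun h => hp ((valOf_eq_top_iff hg hv p).1 h)).symm⟩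
    have := (lineForm_mul hlam hg hv (β := 0) (f := -1) (by simp) hb.ge).1
    rwa [zero_add, neg_one_mul, ← hb] at this
  constructor
  · rintro (⟨h0, -⟩ | h)
    · exact absurd h0 hf
    rw [hβ] at h
    have h1 : (β : ℕ∞) ≤ valOf v g lam f' := by
      have h2 := min_le_valOf_add (lam := lam) hg hv f (-(f - f'))
      rw [show f + -(f - f') = f' by ring] at h2
      exact (le_min hβ.ge (h.le.trans (neg_le _))).trans h2
    have h2 : lineForm v c g lam β f = lineForm v c g lam β f' := by
      have h3 := lineForm_add hg hv h.le h1
      rwa [lineForm_of_lt h, zero_add, sub_add_cancel] at h3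
    have h3 : valOf v g lam f' = β := by
      refine le_antisymm ?_ h1
      by_contra! h4
      rw [lineForm_of_lt h4, hE.lineForm_eq] at h2
      exact T_mul_toLaurent_ne_zero (hE.resPolyOf_ne_zero hg) _ h2
    have hf' : f' ≠ 0 := by
      rintro rfl
      rw [valOf_zero hg hv] at h3
      exact ENat.top_ne_natCast _ h3
    obtain ⟨β', s₀', d', hE'⟩ := exists_isEdge hlam hg hv hf'
    obtain rfl : β = β' := by
      rw [hE'.valOf_eq, Nat.cast_inj] at h3
      exact h3.symm
    exact hE.eq_of_lineForm_eq hg hE' h2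
  · rintro ⟨hS, hR⟩
    right
    have hf' : f' ≠ 0 := by
      rintro rfl
      have := hE.mem_segmentOf
      rw [hS, segmentOf_zero hg] at this
      exact this
    obtain ⟨β', s₀', d', hE'⟩ := exists_isEdge hlam hg hv hf'
    have he : (0 : ℝ) < slopeDen lam := by exact_mod_cast slopeDen_pos lam
    -- A common point of the two segments lies on both lines, which therefore coincide.
    obtain rfl : β = β' := by
      have := hE.mem_segmentOf
      rw [hS, hE'.segmentOf_eq] at this
      have h1 : (β : ℝ) / slopeDen lam - lam * s₀ + lam * s₀ = (β' : ℝ) / slopeDen lam := this.1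
      rw [sub_add_cancel, div_left_inj' he.ne'] at h1
      exact_mod_cast h1
    have hn : nuOf v g lam f = nuOf v g lam f' := by unfold nuOf; rw [hS]
    have h1 : (β : ℕ∞) ≤ valOf v g lam (f - f') := by
      rw [sub_eq_add_neg]
      exact (le_min hβ.ge (hE'.valOf_eq.ge.trans (neg_le _))).trans (min_le_valOf_add hg hv _ _)
    rw [hβ]
    apply lt_valOf_of_lineForm_eq_zero hlam hg hv h1
    have h3 := lineForm_add hg hv h1 hE'.valOf_eq.ge
    rw [sub_add_cancel, hE.lineForm_eq, hE'.lineForm_eq, hn, hR] at h3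
    exact right_eq_add.1 h3

theorem lineForm_eq_of_valOf_eq (hlam : 0 < lam) (hg : IsKey v c g) (hv : IsResidual v c)
    (h : valOf v g lam f = β) : lineForm v c g lam β f =
      LaurentPolynomial.T (nuOf v g lam f) * toLaurent (resPolyOf v c g lam f) := by
  have hf : f ≠ 0 := by
    rintro rfl
    rw [valOf_zero hg hv] at h
    exact ENat.top_ne_natCast _ h
  obtain ⟨β', s₀, d, hE⟩ := exists_isEdge hlam hg hv hf
  obtain rfl : β' = β := by
    rw [hE.valOf_eq, Nat.cast_inj] at h
    exact h
  exact hE.lineForm_eq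

/-- If the residues of the nonzero coefficients of the canonical expansion of `f` are units, then
`f` behaves multiplicatively. -/
theorem mul_of_isUnit (hlam : 0 < lam) (hg : IsKey v c g) (hv : IsResidual v c) (hf : f ≠ 0)
    (hu : ∀ s, adicCoeff g s f ≠ 0 → IsUnit (c (adicCoeff g s f))) (f' : O[X]) :
    valOf v g lam (f * f') = valOf v g lam f + valOf v g lam f' ∧
      segmentOf v g lam (f * f') = segmentOf v g lam f + segmentOf v g lam f' ∧
      resPolyOf v c g lam (f * f') = resPolyOf v c g lam f * resPolyOf v c g lam f' := by
  rcases eq_or_ne f' 0 with rfl | hf'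
  · rw [mul_zero, valOf_zero hg hv, segmentOf_zero hg, resPolyOf_zero hg]
    simp
  obtain ⟨β, s₀, d, hE⟩ := exists_isEdge hlam hg hv hf
  obtain ⟨β', s₀', d', hE'⟩ := exists_isEdge hlam hg hv hf'
  have hu0 : IsUnit ((resPolyOf v c g lam f).coeff 0) := by
    rw [hE.coeff_zero_eq]; exact hu _ hE.left_ne_zero
  have hud : IsUnit (resPolyOf v c g lam f).leadingCoeff := by
    rw [hE.leadingCoeff_eq]; exact hu _ hE.right_ne_zero
  -- A unit times a nonzero element is nonzero even though `A` may have zero divisors. This prevents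
  -- the value from jumping and fixes the left endpoint.
  have h0 : (resPolyOf v c g lam f * resPolyOf v c g lam f').coeff 0 ≠ 0 := by
    rw [mul_coeff_zero]
    intro h
    exact hE'.coeff_zero_ne_zero hg (hu0.mul_right_eq_zero.1 h)
  have hne : resPolyOf v c g lam f * resPolyOf v c g lam f' ≠ 0 := by
    intro h; rw [h] at h0; exact h0 (coeff_zero 0)
  obtain ⟨hle, hW⟩ := lineForm_mul hlam hg hv hE.valOf_eq.ge hE'.valOf_eq.ge
  have hW' : lineForm v c g lam (β + β') (f * f') =
      LaurentPolynomial.T (nuOf v g lam f + nuOf v g lam f') *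
        toLaurent (resPolyOf v c g lam f * resPolyOf v c g lam f') := by
    rw [hW, hE.lineForm_eq, hE'.lineForm_eq, LaurentPolynomial.T_add, map_mul]
    ring
  have hval : valOf v g lam (f * f') = ((β + β' : ℕ) : ℕ∞) := by
    refine le_antisymm ?_ hle
    by_contra! hlt
    rw [lineForm_of_lt hlt] at hW'
    exact T_mul_toLaurent_ne_zero hne _ hW'.symm
  have hff : f * f' ≠ 0 := by
    intro h
    rw [h, valOf_zero hg hv] at hval
    exact ENat.top_ne_natCast _ hval
  obtain ⟨β'', s₀'', d'', hE''⟩ := exists_isEdge hlam hg hv hff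
  obtain rfl : β'' = β + β' := by
    have := hE''.valOf_eq
    rw [hval, Nat.cast_inj] at this
    exact this.symm
  rw [hE''.lineForm_eq] at hW'
  obtain ⟨hn, hR⟩ := T_mul_toLaurent_injective (hE''.coeff_zero_ne_zero hg) h0 hW'
  refine ⟨by rw [hval, hE.valOf_eq, hE'.valOf_eq]; push_cast; rfl, ?_, hR⟩
  have hs : s₀'' = s₀ + s₀' := by
    have h1 := hE''.nuOf_eq
    have h2 := hE.nuOf_eq
    have h3 := hE'.nuOf_eq
    rw [hn] at h1
    push_cast at h1
    have : (s₀'' : ℤ) = s₀ + s₀' := by linear_combination h1 - h2 - h3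
    exact_mod_cast this
  -- The unit leading coefficient makes degrees, hence the lengths of the segments, add up.
  have hd : d'' = d + d' := by
    rw [← hE''.natDegree_eq, hR, natDegree_mul', hE.natDegree_eq, hE'.natDegree_eq]
    intro h
    rw [hud.mul_right_eq_zero, leadingCoeff_eq_zero] at h
    exact hE'.resPolyOf_ne_zero hg h
  rw [hE''.segmentOf_eq, hE.segmentOf_eq, hE'.segmentOf_eq, lineSegment_add, hs, hd]
  · congr 1 <;> push_cast <;> ring
  · exact_mod_cast Nat.le_add_right _ _
  · exact_mod_cast Nat.le_add_right _ _

theorem lineForm_add_lineForm (hlam : 0 < lam) (hg : IsKey v c g) (hv : IsResidual v c)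
    (hf : f ≠ 0) (h : valOf v g lam f = valOf v g lam f') :
    (valOf v g lam f < valOf v g lam (f + f') →
      LaurentPolynomial.T (nuOf v g lam f) * toLaurent (resPolyOf v c g lam f) +
        LaurentPolynomial.T (nuOf v g lam f') * toLaurent (resPolyOf v c g lam f') = 0) ∧
    (valOf v g lam (f + f') = valOf v g lam f →
      LaurentPolynomial.T (nuOf v g lam f) * toLaurent (resPolyOf v c g lam f) +
        LaurentPolynomial.T (nuOf v g lam f') * toLaurent (resPolyOf v c g lam f') =
      LaurentPolynomial.T (nuOf v g lam (f + f')) *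
        toLaurent (resPolyOf v c g lam (f + f'))) := by
  obtain ⟨β, hβ⟩ : ∃ β : ℕ, valOf v g lam f = β :=
    ⟨_, (ENat.natCast_toNat fun h => hf ((valOf_eq_top_iff hg hv f).1 h)).symm⟩
  rw [hβ] at h
  rw [hβ, ← lineForm_eq_of_valOf_eq hlam hg hv hβ, ← lineForm_eq_of_valOf_eq hlam hg hv h.symm,
    ← lineForm_add hg hv hβ.ge h.le]
  exact ⟨fun hlt => lineForm_of_lt hlt, fun heq => lineForm_eq_of_valOf_eq hlam hg hv heq⟩

/-- The right endpoint has abscissa at least `e deg R`, and a nonzero coefficient of the expansion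
there bounds `deg f` from below. -/
theorem le_natDegree_of_dvd_resPolyOf (hlam : 0 < lam) (hg : IsKey v c g) (hv : IsResidual v c)
    (hf : f ≠ 0) {t : A[X]} (ht : t.Monic) (h : t ∣ resPolyOf v c g lam f) :
    slopeDen lam * t.natDegree * g.natDegree ≤ f.natDegree := by
  obtain ⟨β, s₀, d, hE⟩ := exists_isEdge hlam hg hv hf
  obtain ⟨q, hq⟩ := h
  have hq0 : q ≠ 0 := by
    rintro rfl
    rw [mul_zero] at hq
    exact hE.resPolyOf_ne_zero hg hq
  have hd : t.natDegree ≤ d := by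
    rw [← hE.natDegree_eq, hq, ht.natDegree_mul' hq0]
    exact Nat.le_add_right _ _
  refine le_trans ?_ (mul_natDegree_le_of_adicCoeff_ne_zero hg.monic hE.right_ne_zero)
  refine Nat.mul_le_mul_right _ ?_
  rw [mul_comm]
  exact (Nat.mul_le_mul_right _ hd).trans (Nat.le_add_left _ _)

end Edge

/-! ### Passing the invariant to the next order. -/

section Extend

variable {O : Type u} [CommRing O] {A : Type u} [CommRing A]
  {v : O[X] → ℕ∞} {c : O[X] → A} {g : O[X]} {lam : ℚ} {f : O[X]} {t : A[X]}

theorem isUnit_coeff_zero (ht : IsModulus t) (h0 : t.eval 0 ≠ 0) : IsUnit (t.coeff 0) := by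
  rw [← coeff_zero_eq_eval_zero] at h0
  exact ht.2.2.1 0 h0

/-- Evaluating `t = y * divX t + t(0)` at the root exhibits the unit `-t(0)` as a multiple of it. -/
theorem isUnit_root (h : IsUnit (t.coeff 0)) : IsUnit (AdjoinRoot.root t) := by
  have h1 : AdjoinRoot.mk t (t.divX) * AdjoinRoot.root t = -AdjoinRoot.of t (t.coeff 0) := by
    rw [eq_neg_iff_add_eq_zero, ← AdjoinRoot.mk_X, ← AdjoinRoot.mk_C, ← map_mul, ← map_add,
      divX_mul_X_add, AdjoinRoot.mk_self]
  have h2 : IsUnit (-AdjoinRoot.of t (t.coeff 0)) := (h.map (AdjoinRoot.of t)).neg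
  rw [← h1] at h2
  exact isUnit_of_mul_isUnit_right h2

theorem unitZPow_eq {z : A} (hz : IsUnit z) (n : ℤ) : unitZPow z n = ((hz.unit ^ n : Aˣ) : A) :=
  dif_pos hz

theorem isUnit_unitZPow {z : A} (hz : IsUnit z) (n : ℤ) : IsUnit (unitZPow z n) := by
  rw [unitZPow_eq hz]; exact Units.isUnit _

/-- The residue map attached to the extension of `(v, c)` by `(g, lam, t)`. -/
noncomputable def extResidue (v : O[X] → ℕ∞) (c : O[X] → A) (g : O[X]) (lam : ℚ) (t : A[X])
    (f : O[X]) : AdjoinRoot t :=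
  unitZPow (AdjoinRoot.root t) (nuOf v g lam f) * AdjoinRoot.mk t (resPolyOf v c g lam f)

theorem eval₂_T_mul_toLaurent (hz : IsUnit (AdjoinRoot.root t)) (n : ℤ) (p : A[X]) :
    LaurentPolynomial.eval₂ (AdjoinRoot.of t) hz.unit (LaurentPolynomial.T n * toLaurent p) =
      unitZPow (AdjoinRoot.root t) n * AdjoinRoot.mk t p := by
  rw [map_mul, LaurentPolynomial.eval₂_T, LaurentPolynomial.eval₂_toLaurent, unitZPow_eq hz,
    ← AdjoinRoot.aeval_eq]
  rfl

/-- The factor `z^ν` makes the new residue map equal to `lineForm` followed by the ring homomorphism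
`y ↦ z`, so it inherits additivity and multiplicativity. -/
theorem gradedPart_extResidue (hlam : 0 < lam) (hg : IsKey v c g) (hv : IsResidual v c)
    (hz : IsUnit (AdjoinRoot.root t)) {β : ℕ} (hβ : β ≤ valOf v g lam f) :
    gradedPart (valOf v g lam) (extResidue v c g lam t) β f =
      LaurentPolynomial.eval₂ (AdjoinRoot.of t) hz.unit (lineForm v c g lam β f) := by
  rcases hβ.eq_or_lt with h | h
  · rw [gradedPart_of_eq h.symm, lineForm_eq_of_valOf_eq hlam hg hv h.symm,
      eval₂_T_mul_toLaurent hz]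
    rfl
  · rw [gradedPart_of_ne h.ne', lineForm_of_lt h, map_zero]

theorem isResidual_extend (hlam : 0 < lam) (hg : IsKey v c g) (hv : IsResidual v c)
    (hz : IsUnit (AdjoinRoot.root t)) :
    IsResidual (valOf v g lam) (extResidue v c g lam t) where
  val_eq_top_iff := valOf_eq_top_iff hg hv
  min_le_val_add := min_le_valOf_add hg hv
  val_add_le_val_mul f f' := by
    rcases eq_or_ne f 0 with rfl | hf
    · rw [zero_mul, valOf_zero hg hv]; exact le_top
    rcases eq_or_ne f' 0 with rfl | hf'
    · rw [mul_zero, valOf_zero hg hv]; exact le_top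
    obtain ⟨β, _, _, hE⟩ := exists_isEdge hlam hg hv hf
    obtain ⟨β', _, _, hE'⟩ := exists_isEdge hlam hg hv hf'
    have := (lineForm_mul hlam hg hv hE.valOf_eq.ge hE'.valOf_eq.ge).1
    rw [hE.valOf_eq, hE'.valOf_eq]
    exact_mod_cast this
  gradedPart_add β f f' hf hf' := by
    rw [gradedPart_extResidue hlam hg hv hz hf, gradedPart_extResidue hlam hg hv hz hf',
      gradedPart_extResidue hlam hg hv hz ((le_min hf hf').trans (min_le_valOf_add hg hv _ _)),
      lineForm_add hg hv hf hf', map_add]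
  gradedPart_mul β β' f f' hf hf' := by
    obtain ⟨hle, hW⟩ := lineForm_mul hlam hg hv hf hf'
    rw [gradedPart_extResidue hlam hg hv hz hf, gradedPart_extResidue hlam hg hv hz hf',
      gradedPart_extResidue hlam hg hv hz hle, hW, map_mul]

/-- Values add because multiplication by the monic `t = R(G)` is injective; robustness of `G` plays
no role. A polynomial of vanishing residue has residual polynomial divisible by `t`, hence degree at
least `deg G`. -/
theorem isKey_extend (hlam : 0 < lam) (hg : IsKey v c g) (hv : IsResidual v c)
    (hz : IsUnit (AdjoinRoot.root t)) (ht : t.Monic) (hdeg : 0 < t.natDegree) {G : O[X]}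
    (hG : G.Monic) (hGdeg : G.natDegree = slopeDen lam * t.natDegree * g.natDegree)
    (hGres : resPolyOf v c g lam G = t) :
    IsKey (valOf v g lam) (extResidue v c g lam t) G where
  monic := hG
  natDegree_pos := by
    rw [hGdeg]
    exact Nat.mul_pos (Nat.mul_pos (slopeDen_pos lam) hdeg) hg.natDegree_pos
  residue_eq_zero := by
    unfold extResidue
    rw [hGres, AdjoinRoot.mk_self, mul_zero]
  val_mul f := by
    have := hg.nontrivial
    rcases eq_or_ne f 0 with rfl | hf
    · rw [mul_zero, valOf_zero hg hv, add_top]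
    obtain ⟨β, _, _, hE⟩ := exists_isEdge hlam hg hv hG.ne_zero
    obtain ⟨β', _, _, hE'⟩ := exists_isEdge hlam hg hv hf
    obtain ⟨hle, hW⟩ := lineForm_mul hlam hg hv hE.valOf_eq.ge hE'.valOf_eq.ge
    rw [hE.valOf_eq, hE'.valOf_eq]
    refine le_antisymm ?_ (by exact_mod_cast hle)
    by_contra! hlt
    have hlt' : ((β + β' : ℕ) : ℕ∞) < valOf v g lam (G * f) := by exact_mod_cast hlt
    rw [lineForm_of_lt hlt', hE.lineForm_eq, hE'.lineForm_eq, hGres] at hW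
    refine T_mul_toLaurent_ne_zero (ht.mul_right_ne_zero (hE'.resPolyOf_ne_zero hg))
      (nuOf v g lam G + nuOf v g lam f) ?_
    rw [LaurentPolynomial.T_add, map_mul, hW]
    ring
  residue_ne_zero a ha hlt h := by
    unfold extResidue at h
    rw [(isUnit_unitZPow hz _).mul_right_eq_zero, AdjoinRoot.mk_eq_zero] at h
    have h1 := le_natDegree_of_dvd_resPolyOf hlam hg hv ha ht h
    have h2 := natDegree_lt_natDegree ha hlt
    omega

end Extend

/-! ### Order zero: the `N`-adic pseudo-valuation. -/

section Base

variable {O : Type u} [CommRing O] {N : ℕ}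

/-- These are the only facts about the base ring that enter the proof; Noetherianity makes the
multiplicity of `N` in a nonzero polynomial finite. -/
theorem IsBaseRing.properties (hO : IsBaseRing O N) :
    IsDomain O ∧ IsNoetherianRing O ∧ (N : O) ≠ 0 ∧ ¬IsUnit (N : O) := by
  rcases hO with ⟨hN, ⟨e⟩⟩ | ⟨hN, ⟨e⟩⟩
  · refine ⟨e.toMulEquiv.isDomain ℤ, isNoetherianRing_of_ringEquiv ℤ e.symm, ?_, ?_⟩
    · intro h
      have := congrArg e h
      rw [map_natCast, map_zero] at this
      have : N = 0 := by exact_mod_cast this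
      omega
    · intro h
      have := h.map e
      rw [map_natCast, Int.isUnit_iff_natAbs_eq, Int.natAbs_natCast] at this
      omega
  · refine ⟨e.toMulEquiv.isDomain (PadicInt N), isNoetherianRing_of_ringEquiv (PadicInt N) e.symm,
      ?_, ?_⟩
    · intro h
      have := congrArg e h
      rw [map_natCast, map_zero] at this
      exact PadicInt.prime_p.ne_zero this
    · intro h
      have := h.map e
      rw [map_natCast] at this
      exact PadicInt.prime_p.not_isUnit this

theorem natCast_le_val0_iff {k : ℕ} {f : O[X]} :
    (k : ℕ∞) ≤ val0 N f ↔ C (N : O) ^ k ∣ f := by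
  unfold val0 ordN
  rw [le_iInf_iff, ← C_pow, C_dvd_iff_dvd_coeff]
  exact forall_congr' fun s => pow_dvd_iff_le_emultiplicity.symm

theorem val0_eq (N : ℕ) (f : O[X]) : val0 N f = emultiplicity (C (N : O)) f :=
  ENat.eq_of_forall_natCast_le_iff fun k => by
    rw [natCast_le_val0_iff, pow_dvd_iff_le_emultiplicity]

theorem map_mk_eq_zero_iff {q : O[X]} :
    q.map (Ideal.Quotient.mk (Ideal.span {(N : O)})) = 0 ↔ C (N : O) ∣ q := by
  rw [C_dvd_iff_dvd_coeff, Polynomial.ext_iff]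
  refine forall_congr' fun s => ?_
  rw [coeff_map, coeff_zero, Ideal.Quotient.eq_zero_iff_mem, Ideal.mem_span_singleton]

theorem val0_eq_top_iff (hO : IsBaseRing O N) (f : O[X]) : val0 N f = ⊤ ↔ f = 0 := by
  obtain ⟨h1, h2, h3, h4⟩ := hO.properties
  rw [val0_eq, emultiplicity_eq_top]
  constructor
  · contrapose!
    intro hf
    exact FiniteMultiplicity.of_not_isUnit (fun h => h4 (isUnit_C.1 h)) hf
  · rintro rfl h
    exact h.ne_zero rfl

theorem C_pow_mul_cancel (hO : IsBaseRing O N) {k : ℕ} {q q' : O[X]}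
    (h : C (N : O) ^ k * q = C (N : O) ^ k * q') : q = q' := by
  obtain ⟨h1, -, h3, -⟩ := hO.properties
  exact mul_left_cancel₀ (pow_ne_zero k (C_ne_zero.2 h3)) h

theorem res0_of_val0_eq (hO : IsBaseRing O N) {k : ℕ} {q : O[X]}
    (h : val0 N (C (N : O) ^ k * q) = k) :
    res0 N (C (N : O) ^ k * q) = q.map (Ideal.Quotient.mk (Ideal.span {(N : O)})) := by
  have hne : C (N : O) ^ k * q ≠ 0 := by
    intro h0
    rw [(val0_eq_top_iff hO _).2 h0] at h
    exact ENat.top_ne_natCast _ h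
  have hex : C (N : O) ^ k * q ≠ 0 ∧ ∃ q' : O[X],
      C (N : O) ^ k * q = C ((N : O) ^ (val0 N (C (N : O) ^ k * q)).toNat) * q' :=
    ⟨hne, q, by rw [h, ENat.toNat_natCast, C_pow]⟩
  unfold res0
  rw [dif_pos hex]
  congr 1
  refine (C_pow_mul_cancel hO (k := k) (hex.2.choose_spec.trans ?_)).symm
  congr 1
  rw [h, ENat.toNat_natCast, C_pow]

/-- If the value exceeds `k`, then `N` divides `q` and both sides vanish. So the degree `k` part is
reduction of the cofactor of `N^k`, visibly compatible with sums and products. -/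
theorem gradedPart_base (hO : IsBaseRing O N) (t : (BaseAlg O N)[X]) (k : ℕ) (q : O[X]) :
    gradedPart (val0 N) (fun a => AdjoinRoot.mk t (res0 N a)) k (C (N : O) ^ k * q) =
      AdjoinRoot.mk t (q.map (Ideal.Quotient.mk (Ideal.span {(N : O)}))) := by
  by_cases h : val0 N (C (N : O) ^ k * q) = k
  · rw [gradedPart_of_eq h, res0_of_val0_eq hO h]
  · rw [gradedPart_of_ne h]
    have h1 : ((k + 1 : ℕ) : ℕ∞) ≤ val0 N (C (N : O) ^ k * q) := by
      have := lt_of_le_of_ne (natCast_le_val0_iff.2 (Dvd.intro q rfl)) (Ne.symm h)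
      exact_mod_cast Order.add_one_le_of_lt this
    obtain ⟨q', hq'⟩ := natCast_le_val0_iff.1 h1
    rw [pow_succ, mul_assoc] at hq'
    rw [map_mk_eq_zero_iff.2 ⟨q', C_pow_mul_cancel hO hq'⟩, map_zero]

theorem isResidual_base (hO : IsBaseRing O N) (t : (BaseAlg O N)[X]) :
    IsResidual (val0 N) (fun a : O[X] => AdjoinRoot.mk t (res0 N a)) where
  val_eq_top_iff := val0_eq_top_iff hO
  min_le_val_add f f' := by
    rw [val0_eq, val0_eq, val0_eq]
    exact min_le_emultiplicity_add
  val_add_le_val_mul f f' := by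
    rcases eq_or_ne f 0 with rfl | hf
    · rw [zero_mul, (val0_eq_top_iff hO 0).2 rfl]; exact le_top
    rcases eq_or_ne f' 0 with rfl | hf'
    · rw [mul_zero, (val0_eq_top_iff hO 0).2 rfl]; exact le_top
    have h1 := ENat.natCast_toNat (mt (val0_eq_top_iff hO f).1 hf)
    have h2 := ENat.natCast_toNat (mt (val0_eq_top_iff hO f').1 hf')
    rw [← h1, ← h2, ← Nat.cast_add, natCast_le_val0_iff, pow_add]
    exact mul_dvd_mul (natCast_le_val0_iff.1 h1.le) (natCast_le_val0_iff.1 h2.le)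
  gradedPart_add k f f' hf hf' := by
    obtain ⟨q, rfl⟩ := natCast_le_val0_iff.1 hf
    obtain ⟨q', rfl⟩ := natCast_le_val0_iff.1 hf'
    rw [← mul_add, gradedPart_base hO, gradedPart_base hO, gradedPart_base hO,
      Polynomial.map_add, map_add]
  gradedPart_mul k k' f f' hf hf' := by
    obtain ⟨q, rfl⟩ := natCast_le_val0_iff.1 hf
    obtain ⟨q', rfl⟩ := natCast_le_val0_iff.1 hf'
    rw [show C (N : O) ^ k * q * (C (N : O) ^ k' * q') = C (N : O) ^ (k + k') * (q * q') by ring,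
      gradedPart_base hO, gradedPart_base hO, gradedPart_base hO, Polynomial.map_mul, map_mul]

/-- A monic polynomial stays monic modulo `N`, hence is not a zero divisor there, so powers of `N`
can be removed one at a time. -/
theorem val0_monic_mul (hO : IsBaseRing O N) {g : O[X]} (hg : g.Monic) (f : O[X]) :
    val0 N (g * f) = val0 N f := by
  refine ENat.eq_of_forall_natCast_le_iff fun k => ?_
  rw [natCast_le_val0_iff, natCast_le_val0_iff]
  refine ⟨fun h => ?_, fun h => h.mul_left g⟩
  induction k generalizing f with
  | zero => simp
  | succ k ih =>
    obtain ⟨q, rfl⟩ := ih f ((pow_dvd_pow _ k.le_succ).trans h)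
    obtain ⟨q', hq'⟩ := h
    rw [pow_succ, mul_assoc, mul_left_comm] at hq'
    have h1 := map_mk_eq_zero_iff.2 ⟨q', C_pow_mul_cancel hO hq'⟩
    rw [Polynomial.map_mul, (hg.map _).mul_right_eq_zero_iff, map_mk_eq_zero_iff] at h1
    rw [pow_succ]
    exact mul_dvd_mul_left _ h1

theorem val0_monic (hO : IsBaseRing O N) {g : O[X]} (hg : g.Monic) : val0 N g = 0 := by
  have h4 := hO.properties.2.2.2
  rw [val0_eq, emultiplicity_eq_zero, C_dvd_iff_dvd_coeff]
  intro h
  have := h g.natDegree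
  rw [hg.coeff_natDegree] at this
  exact h4 (isUnit_of_dvd_one this)

theorem isKey_base (hO : IsBaseRing O N) {t : (BaseAlg O N)[X]} (ht : t.Monic)
    (hdeg : 0 < t.natDegree) {g : O[X]} (hg : g.Monic) (hres : res0 N g = t) :
    IsKey (val0 N) (fun a : O[X] => AdjoinRoot.mk t (res0 N a)) g := by
  have : Nontrivial (BaseAlg O N) := by
    by_contra h
    rw [not_nontrivial_iff_subsingleton] at h
    rw [Subsingleton.elim t 0] at hdeg
    simp at hdeg
  -- A monic polynomial has value `0`, so its residual polynomial is its plain reduction.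
  have hgt : g.map (Ideal.Quotient.mk (Ideal.span {(N : O)})) = t := by
    have h0 : val0 N (C (N : O) ^ 0 * g) = ((0 : ℕ) : ℕ∞) := by
      rw [pow_zero, one_mul, val0_monic hO hg]; rfl
    have := res0_of_val0_eq hO h0
    rw [pow_zero, one_mul, hres] at this
    exact this.symm
  have hgd : g.natDegree = t.natDegree := by rw [← hgt, hg.natDegree_map]
  refine ⟨hg, hgd ▸ hdeg, ?_, fun f => ?_, fun a ha hlt h => ?_⟩
  · simp only [hres, AdjoinRoot.mk_self]
  · rw [val0_monic_mul hO hg, val0_monic hO hg, zero_add]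
  · have hk := ENat.natCast_toNat (mt (val0_eq_top_iff hO a).1 ha)
    obtain ⟨q, hq⟩ := natCast_le_val0_iff.1 hk.le
    have hkq := hk.symm
    generalize (val0 N a).toNat = k at hq hkq
    subst hq
    rw [res0_of_val0_eq hO hkq, AdjoinRoot.mk_eq_zero] at h
    have hdom := hO.properties
    have := hdom.1
    have hqd : q.degree < g.degree := by
      rwa [← C_pow, degree_C_mul (pow_ne_zero k hdom.2.2.1)] at hlt
    -- The reduction of `q` is a multiple of the monic `t` of degree below `deg t`.
    have hmap : q.map (Ideal.Quotient.mk (Ideal.span {(N : O)})) = 0 := by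
      by_contra hne
      refine ht.not_dvd_of_degree_lt hne ?_ h
      rw [← hgt, hg.degree_map]
      exact degree_map_le.trans_lt hqd
    have h5 : ((k + 1 : ℕ) : ℕ∞) ≤ val0 N (C (N : O) ^ k * q) := by
      rw [natCast_le_val0_iff, pow_succ]
      exact mul_dvd_mul_left _ (map_mk_eq_zero_iff.1 hmap)
    rw [hkq, Nat.cast_le] at h5
    omega

end Base

/-! ### Euclid's algorithm and the induction on the order. -/

section Types

/-- Each step stays inside the ideal generated by the input, whatever `Ring.inverse` returns and
whether or not the normalised divisor is monic. Hence the outcome of the tests does not matter here.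
-/
theorem EuclidGcd.mem_span {A : Type u} [CommRing A] {P : A → Prop} {s t d : A[X]}
    (h : EuclidGcd P s t d) : d ∈ Ideal.span {s, t} := by
  induction h with
  | done s => exact Ideal.subset_span (Set.mem_insert _ _)
  | step s t d ht hP hrec ih =>
    refine Ideal.span_le.2 ?_ ih
    have hs : s ∈ Ideal.span {s, t} := Ideal.subset_span (Set.mem_insert _ _)
    have ht' : C (Ring.inverse t.leadingCoeff) * t ∈ Ideal.span {s, t} :=
      Ideal.mul_mem_left _ _ (Ideal.subset_span (Set.mem_insert_of_mem _ rfl))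
    rintro x (rfl | rfl)
    · exact ht'
    · have := modByMonic_add_div s (C (Ring.inverse t.leadingCoeff) * t)
      rw [SetLike.mem_coe, eq_sub_of_add_eq this]
      exact Ideal.sub_mem _ hs (Ideal.mul_mem_right _ _ ht')

theorem EuclidGcd.isUnit_mk {A : Type u} [CommRing A] {P : A → Prop} {s t : A[X]}
    (h : EuclidGcd P s t 1) : IsUnit (AdjoinRoot.mk t s) := by
  obtain ⟨x, y, hxy⟩ := Ideal.mem_span_pair.1 h.mem_span
  have := congrArg (AdjoinRoot.mk t) hxy
  rw [map_add, map_mul, map_mul, AdjoinRoot.mk_self, mul_zero, add_zero, map_one] at this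
  exact IsUnit.of_mul_eq_one_right _ this

namespace TypeData

variable {O : Type u} [CommRing O] {N : ℕ}

theorem isResidual_and_isKey (hO : IsBaseRing O N) {r : ℕ} {A : Type u} {inst : CommRing A}
    (T : TypeData O N r A inst) (hT : T.IsSFType) :
    IsResidual T.val T.resValue ∧
      ∀ g : O[X], T.IsRepresentative g → IsKey T.val T.resValue g := by
  induction T with
  | base t =>
    have hT' : IsModulus t := hT
    exact ⟨isResidual_base hO t, fun g hg => isKey_base hO hT'.1 hT'.2.2.2 hg.1 hg.2.2⟩
  | extend T g lam t ih =>
    obtain ⟨h1, h2, hlam, ht, h0⟩ := hT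
    obtain ⟨hv, hk⟩ := ih h1
    have hg := hk g h2
    have hz := isUnit_root (isUnit_coeff_zero ht h0)
    exact ⟨isResidual_extend hlam hg hv hz, fun G hG =>
      isKey_extend hlam hg hv hz ht.1 ht.2.2.2 hG.1 hG.2.2.1 hG.2.2.2⟩

/-- Output `1` gives a Bézout relation, so the class of the residual polynomial modulo `t` is a
unit; the extra factor is a power of the unit `z`. -/
theorem isUnit_resValue_of_gcdOne {r : ℕ} {A : Type u} {inst : CommRing A}
    (T : TypeData O N r A inst) (hT : T.IsSFType) {a : O[X]} (ha : T.GcdOne a) :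
    IsUnit (T.resValue a) := by
  cases T with
  | base t => exact EuclidGcd.isUnit_mk ha
  | extend T g lam t =>
    obtain ⟨-, -, -, ht, h0⟩ := hT
    exact (isUnit_unitZPow (isUnit_root (isUnit_coeff_zero ht h0)) _).mul (EuclidGcd.isUnit_mk ha)

end TypeData

end Types

end SFOM

/-! ### The theorem. -/

theorem theorem2 {O : Type u} [CommRing O] {N : ℕ} (hO : SFOM.IsBaseRing O N)
    {r : ℕ} {A : Type u} [inst : CommRing A]
    (T' : SFOM.TypeData O N r A inst) (gr : O[X]) (lam : ℚ) (t : A[X])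
    (hT : (T'.extend gr lam t).IsSFType)
    (f h : O[X]) (hf : f ≠ 0) :
    -- (A)
    (SFOM.VEquiv (T'.extend gr lam t).val f h ↔
      T'.segment gr lam f = T'.segment gr lam h ∧ T'.resPoly gr lam f = T'.resPoly gr lam h) ∧
    -- (B)
    ((T'.extend gr lam t).val f = (T'.extend gr lam t).val h →
      ((T'.extend gr lam t).val f < (T'.extend gr lam t).val (f + h) →
        LaurentPolynomial.T (T'.nu gr lam f) * toLaurent (T'.resPoly gr lam f) +
          LaurentPolynomial.T (T'.nu gr lam h) * toLaurent (T'.resPoly gr lam h) = 0) ∧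
      ((T'.extend gr lam t).val (f + h) = (T'.extend gr lam t).val f →
        LaurentPolynomial.T (T'.nu gr lam f) * toLaurent (T'.resPoly gr lam f) +
          LaurentPolynomial.T (T'.nu gr lam h) * toLaurent (T'.resPoly gr lam h) =
        LaurentPolynomial.T (T'.nu gr lam (f + h)) * toLaurent (T'.resPoly gr lam (f + h)))) ∧
    -- (C)
    ((T'.extend gr lam t).Robust f →
      (T'.extend gr lam t).val (f * h) =
        (T'.extend gr lam t).val f + (T'.extend gr lam t).val h ∧
      T'.segment gr lam (f * h) = T'.segment gr lam f + T'.segment gr lam h ∧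
      T'.resPoly gr lam (f * h) = T'.resPoly gr lam f * T'.resPoly gr lam h) ∧
    -- (D)
    (∀ g : O[X], (T'.extend gr lam t).IsRepresentative g →
      (SFOM.VEquiv (T'.extend gr lam t).val f (g * h) → t ∣ T'.resPoly gr lam f) ∧
      (t ∣ T'.resPoly gr lam f → g.degree ≤ f.degree) ∧
      IsLeast (Set.range fun s : ℕ =>
          (T'.extend gr lam t).val (SFOM.adicCoeff g s f * g ^ s))
        ((T'.extend gr lam t).val f)) := by
  -- The invariant is used at two orders: here for the full type, which yields (D2), and below for
  -- `T'`, which yields the rest.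
  obtain ⟨hv', hk'⟩ := (T'.extend gr lam t).isResidual_and_isKey hO hT
  obtain ⟨hT', hrep, hlam, ht, h0⟩ := hT
  obtain ⟨hv, hk⟩ := T'.isResidual_and_isKey hO hT'
  have hg := hk gr hrep
  have hmul : ∀ f : O[X], (T'.extend gr lam t).Robust f → ∀ h,
      (T'.extend gr lam t).val (f * h) =
        (T'.extend gr lam t).val f + (T'.extend gr lam t).val h ∧
      T'.segment gr lam (f * h) = T'.segment gr lam f + T'.segment gr lam h ∧
      T'.resPoly gr lam (f * h) = T'.resPoly gr lam f * T'.resPoly gr lam h :=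
    fun f hR h => SFOM.mul_of_isUnit hlam hg hv hR.1
      (fun s hs => T'.isUnit_resValue_of_gcdOne hT' (hR.2 s hs).2) h
  refine ⟨SFOM.vEquiv_iff hlam hg hv hf, SFOM.lineForm_add_lineForm hlam hg hv hf,
    fun hR => hmul f hR h, fun g hG => ⟨fun heq => ?_, fun hdvd => ?_, (hk' g hG).isLeast_val hv' f⟩⟩
  · have h1 : T'.resPoly gr lam f = T'.resPoly gr lam (g * h) :=
      ((SFOM.vEquiv_iff hlam hg hv hf).1 heq).2
    have h2 : T'.resPoly gr lam g = t := hG.2.2.2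
    rw [h1, (hmul g hG.2.1 h).2.2, h2]
    exact dvd_mul_right t _
  · have := hg.nontrivial
    rw [degree_eq_natDegree hG.1.ne_zero, degree_eq_natDegree hf, hG.2.2.1, Nat.cast_le]
    exact SFOM.le_natDegree_of_dvd_resPolyOf hlam hg hv hf ht.1 hdvd
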